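/- **Setting.** Let $A$ be a nonnegative self-adjoint (possibly unbounded) linear operator on a real Hilbert space $H$. Assume that there are a countable, not necessarily complete, orthonormal system $\{e_k\}_{k\ge1}$ in $H$ and an increasing unbounded sequence $\{\lambda_k\}_{k\ge 1}$ of positive real numbers with $Ae_k=\lambda_k^2e_k$ for all $k$. For $u\in H$ let $\mu_u$ be the spectral measure of $u$ with respect to $A$, and set $|A^\beta u|^2=\int x^{2\beta}\,d\mu_u(x)\in[0,\infty]$, $D(A^\beta)=\{u\in H: |A^\beta u|<\infty\}$ (with the graph norm), $V_\beta=D(A^{(\beta+1)/2})\times D(A^{\beta/2})$. For $\varphi:[0,\infty)\to[1,\infty)$, $r>0$ and $\beta>0$ let $$\mathcal G_{\varphi,r,\beta}(A)=\Big\{u\in H:\ \int x^{2\beta}\exp\big(r\varphi(\sqrt x)\big)\,d\mu_u(x)<\infty\Big\};$$ if $u=\sum_k u_ke_k$, the integral is $\sum_k\lambda_k^{4\beta}u_k^2\exp(r\varphi(\lambda_k))$. Let $\omega:[0,\infty)\to[0,\infty)$ be continuous and increasing, with $\omega(0)=0$, $\omega(\sigma)>0$ for $\sigma>0$, $\omega(a+b)\le\omega(a)+\omega(b)$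 for all $a,b\ge0$, and $\sigma\mapsto\sigma/\omega(\sigma)$ nondecreasing on $(0,\infty)$. (Here, and for $\{\lambda_k\}$, "increasing" need not be strict.) A function $m:[0,\infty)\to\mathbb R$ is $\omega$-continuous if there is a constant $L$ with $|m(a)-m(b)|\le L\,\omega(|a-b|)$ for all $a,b\ge0$. **Theorem.** Let $\varphi:[0,\infty)\to[1,\infty)$ be a function such that $$\lim_{\sigma\to+\infty}\sigma\left[\varphi\left(\frac{\sigma}{\sqrt{\omega(1/\sigma)}}\right)\right]^{-1}=+\infty .$$ Then there exist a function $m:[0,\infty)\to[0,3/2]$, a real number $T_0>0$ and a function $u:[0,T_0]\to H$ such that 1. $m$ is $\omega$-continuous; 2. $(u(0),u'(0))\in\mathcal G_{\varphi,r,3/4}(A)\times\mathcal G_{\varphi,r,1/4}(A)$ for every $r>0$; 3. $u\in C^1([0,T_0];D(A^{1/4}))\cap C^0([0,T_0];D(A^{3/4}))$ is a solution of $u''(t)+m(|A^{1/2}u(t)|^2)\,Au(t)=0$ on $[0,T_0]$, in the sense that $\frac{d}{dt}\langle u'(t),w\rangle=-m(|A^{1/2}u(t)|^2)\,\langle u(t),Aw\rangle$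 for every $w\in D(A)$ and every $t\in[0,T_0]$; 4. for every $t\in(0,T_0]$ and every $\beta\ge1$, $(u(t),u'(t))\notin V_\beta$; 5. there is a sequence $\tau_k\to0^+$ in $(0,T_0]$ such that, for every $\beta>1/2$, $\limsup_{k\to\infty}|A^{(\beta+1)/2}u(\tau_k)|=+\infty$. -/

import Mathlib

open Set Filter Topology MeasureTheory
open scoped NNReal ENNReal RealInnerProductSpace

namespace Kirchhoff

/-! ### Moduli of continuity -/

/-- A modulus of continuity on `[0, ∞)`: continuous, increasing, vanishing exactly at `0`,
subadditive, and such that `σ / ω σ` is nondecreasing on `(0, ∞)`.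
(Increasing is read in the weak sense, together with positivity on `(0, ∞)`; every strictly
increasing `ω` with `ω 0 = 0` is covered.) -/
structure IsModulus (ω : ℝ → ℝ) : Prop where
  continuousOn : ContinuousOn ω (Ici 0)
  monotoneOn : MonotoneOn ω (Ici 0)
  map_zero : ω 0 = 0
  pos : ∀ σ, 0 < σ → 0 < ω σ
  add_le : ∀ a b, 0 ≤ a → 0 ≤ b → ω (a + b) ≤ ω a + ω b
  div_monotoneOn : MonotoneOn (fun σ => σ / ω σ) (Ioi 0)

/-- `f` is `ω`-continuous on `X ⊆ ℝ`. -/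
def OmegaContinuousOn (ω f : ℝ → ℝ) (X : Set ℝ) : Prop :=
  ∃ L : ℝ, ∀ a ∈ X, ∀ b ∈ X, |f a - f b| ≤ L * ω |a - b|

/-! ### Spectral measures of a nonnegative self-adjoint operator

`A` is an unbounded operator on a real Hilbert space `H`.  When `A` is self-adjoint and nonnegative,
every `u : H` has a spectral measure `μ_u` with respect to `A`: the finite Borel measure carried by
`[0, ∞)` such that `⟪f(A) u, u⟫ = ∫ f dμ_u` for all bounded Borel functions `f`.  It is determined by
its values on the functions `f(x) = (1 + x)⁻ⁿ`, that is, on the powers of the resolvent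
`(1 + A)⁻¹`. -/

section

variable {H : Type*} [NormedAddCommGroup H] [InnerProductSpace ℝ H]

/-- `A` is nonnegative. -/
def IsNonneg (A : H →ₗ.[ℝ] H) : Prop := ∀ x : A.domain, 0 ≤ ⟪A x, (x : H)⟫

/-- `μ` is the spectral measure of `u` with respect to `A`: it is a finite measure carried by
`[0, ∞)` with `⟪(1 + A)⁻ⁿ u, u⟫ = ∫ (1 + x)⁻ⁿ dμ(x)` for every `n`.  Here `w n = (1 + A)⁻ⁿ u`, which is
expressed by `w 0 = u`, `w (n + 1) ∈ D(A)` and `A (w (n + 1)) = w n - w (n + 1)`. -/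
structure IsSpectralMeasure (A : H →ₗ.[ℝ] H) (u : H) (μ : Measure ℝ) : Prop where
  finite : IsFiniteMeasure μ
  nonneg : μ (Iio 0) = 0
  resolvent : ∃ w : ℕ → H, w 0 = u ∧
    (∀ n, ∃ h : w (n + 1) ∈ A.domain, A ⟨w (n + 1), h⟩ = w n - w (n + 1)) ∧
    ∀ n, ⟪w n, u⟫ = ∫ x, ((1 + x) ^ n)⁻¹ ∂μ

/-- A finite measure carried by `[0, ∞)` is determined by the integrals of `(1 + x)⁻ⁿ`. -/
theorem measure_eq_of_resolvent_moments {μ ν : Measure ℝ} [IsFiniteMeasure μ] [IsFiniteMeasure ν]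
    (hμ : μ (Iio 0) = 0) (hν : ν (Iio 0) = 0)
    (h : ∀ n : ℕ, ∫ x, ((1 + x) ^ n)⁻¹ ∂μ = ∫ x, ((1 + x) ^ n)⁻¹ ∂ν) : μ = ν := by
  have aeμ : ∀ᵐ x ∂μ, 0 ≤ x := by
    rw [ae_iff]; convert hμ using 2; ext x; simp
  have aeν : ∀ᵐ x ∂ν, 0 ≤ x := by
    rw [ae_iff]; convert hν using 2; ext x; simp
  set f : ℝ → ℝ := fun x => (1 + max x 0)⁻¹ with hf
  have hf0 : ∀ x, f x ∈ Icc (0 : ℝ) 1 := fun x =>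
    ⟨inv_nonneg.mpr (by linarith [le_max_right x 0]),
      inv_le_one_of_one_le₀ (by linarith [le_max_right x 0])⟩
  have hfc : Continuous f :=
    (continuous_const.add (continuous_id.max continuous_const)).inv₀ fun x => ne_of_gt <| by
      have := le_max_right x 0
      show (0 : ℝ) < 1 + max x 0
      linarith
  have hfm : Measurable f := hfc.measurable
  have hmom : ∀ n : ℕ, ∫ x, f x ^ n ∂μ = ∫ x, f x ^ n ∂ν := by
    intro n
    have key : ∀ x : ℝ, 0 ≤ x → f x ^ n = ((1 + x) ^ n)⁻¹ := fun x hx => by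
      simp [hf, max_eq_left hx]
    rw [integral_congr_ae (aeμ.mono key), integral_congr_ae (aeν.mono key), h n]
  have hint : ∀ (ρ : Measure ℝ) [IsFiniteMeasure ρ] (g : ℝ → ℝ), Continuous g →
      Integrable (fun x => g (f x)) ρ := by
    intro ρ _ g hg
    obtain ⟨C, hC⟩ := isCompact_Icc.exists_bound_of_continuousOn (hg.continuousOn (s := Icc 0 1))
    exact Integrable.of_bound (hg.comp hfc).aestronglyMeasurable C
      (Eventually.of_forall fun x => hC _ (hf0 x))
  have hpoly : ∀ p : Polynomial ℝ, ∫ x, p.eval (f x) ∂μ = ∫ x, p.eval (f x) ∂ν := by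
    intro p
    simp only [Polynomial.eval_eq_sum_range]
    rw [integral_finsetSum _ fun i _ => (hint μ (fun y => y ^ i) (by fun_prop)).const_mul _,
      integral_finsetSum _ fun i _ => (hint ν (fun y => y ^ i) (by fun_prop)).const_mul _]
    simp only [integral_const_mul, hmom]
  have hmap : μ.map f = ν.map f := by
    refine ext_of_forall_integral_eq_of_IsFiniteMeasure fun g => ?_
    rw [integral_map hfm.aemeasurable g.continuous.aestronglyMeasurable,
      integral_map hfm.aemeasurable g.continuous.aestronglyMeasurable]
    refine eq_of_forall_dist_le fun ε hε => ?_
    set K : ℝ := μ.real univ + ν.real univ + 1 with hK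
    have hKpos : 0 < K := by positivity
    obtain ⟨p, hp⟩ := exists_polynomial_near_of_continuousOn 0 1 g g.continuous.continuousOn
      (ε / K) (by positivity)
    have est : ∀ (ρ : Measure ℝ) [IsFiniteMeasure ρ],
        ‖∫ x, g (f x) ∂ρ - ∫ x, p.eval (f x) ∂ρ‖ ≤ ε / K * ρ.real univ := by
      intro ρ _
      rw [← integral_sub (hint ρ g g.continuous) (hint ρ _ p.continuous)]
      refine norm_integral_le_of_norm_le_const (Eventually.of_forall fun x => ?_)
      rw [Real.norm_eq_abs, abs_sub_comm]
      exact (hp _ (hf0 x)).le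
    have e1 := est μ
    have e2 := est ν
    rw [hpoly p] at e1
    rw [norm_sub_rev] at e2
    rw [dist_eq_norm]
    calc _ ≤ ε / K * μ.real univ + ε / K * ν.real univ :=
          (norm_sub_le_norm_sub_add_norm_sub _ _ _).trans (add_le_add e1 e2)
      _ = ε / K * (K - 1) := by rw [hK]; ring
      _ ≤ ε / K * K := by gcongr; linarith
      _ = ε := by field_simp
  have hg : Measurable fun y : ℝ => y⁻¹ - 1 := by fun_prop
  have back : ∀ ρ : Measure ℝ, (∀ᵐ x ∂ρ, 0 ≤ x) →
      (ρ.map f).map (fun y : ℝ => y⁻¹ - 1) = ρ := by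
    intro ρ hρ
    rw [Measure.map_map hg hfm]
    conv_rhs => rw [← Measure.map_id (μ := ρ)]
    refine Measure.map_congr (hρ.mono fun x hx => ?_)
    simp [hf, max_eq_left hx]
  rw [← back μ aeμ, hmap, back ν aeν]

/-- The spectral measure is unique. -/
theorem IsSpectralMeasure.unique {A : H →ₗ.[ℝ] H} (hA : IsNonneg A) {u : H} {μ ν : Measure ℝ}
    (hμ : IsSpectralMeasure A u μ) (hν : IsSpectralMeasure A u ν) : μ = ν := by
  obtain ⟨fμ, nμ, w, w0, hw, iw⟩ := hμ
  obtain ⟨fν, nν, z, z0, hz, iz⟩ := hν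
  have hwz : ∀ n, w n = z n := by
    intro n
    induction n with
    | zero => rw [w0, z0]
    | succ n ih =>
      obtain ⟨h1, e1⟩ := hw n
      obtain ⟨h2, e2⟩ := hz n
      have h3 := hA (⟨w (n + 1), h1⟩ - ⟨z (n + 1), h2⟩)
      rw [LinearPMap.map_sub, e1, e2, ih] at h3
      have h4 : z n - w (n + 1) - (z n - z (n + 1)) = -(w (n + 1) - z (n + 1)) := by abel
      rw [h4, inner_neg_left] at h3
      have h5 : ⟪w (n + 1) - z (n + 1), w (n + 1) - z (n + 1)⟫ ≤ 0 := by
        simpa using h3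
      rw [real_inner_self_eq_norm_sq] at h5
      exact sub_eq_zero.mp (norm_eq_zero.mp (by nlinarith [norm_nonneg (w (n + 1) - z (n + 1))]))
  exact measure_eq_of_resolvent_moments nμ nν fun n => by rw [← iw n, ← iz n, hwz n]

open Classical in
/-- The spectral measure of `u` with respect to `A`.  (For a nonnegative self-adjoint `A` it exists
by the spectral theorem, so that the default value `0` is never taken.) -/
noncomputable def spectralMeasure (A : H →ₗ.[ℝ] H) (u : H) : Measure ℝ :=
  if h : ∃ μ, IsSpectralMeasure A u μ then h.choose else 0

/-! ### Fractional powers and the spaces attached to them -/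

/-- The norm `|A^β u| = (∫ x^{2β} dμ_u(x))^{1/2}`, with value `∞` when `u ∉ D(A^β)`.  If
`u = ∑ u_k e_k` with `A e_k = λ_k² e_k`, its square is `∑ λ_k^{4β} u_k²`. -/
noncomputable def powNorm (A : H →ₗ.[ℝ] H) (β : ℝ) (u : H) : ℝ≥0∞ :=
  (∫⁻ x, ENNReal.ofReal (x ^ (2 * β)) ∂(spectralMeasure A u)) ^ (1 / 2 : ℝ)

/-- The domain `D(A^β)`. -/
def powDomain (A : H →ₗ.[ℝ] H) (β : ℝ) : Set H := {u | powNorm A β u < ∞}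

/-- The graph norm `|u| + |A^β u|` of `D(A^β)`. -/
noncomputable def graphNorm (A : H →ₗ.[ℝ] H) (β : ℝ) (u : H) : ℝ≥0∞ :=
  ‖u‖ₑ + powNorm A β u

/-- The phase space `V_β = D(A^{(β+1)/2}) × D(A^{β/2})`. -/
def phaseSpace (A : H →ₗ.[ℝ] H) (β : ℝ) : Set (H × H) :=
  powDomain A ((β + 1) / 2) ×ˢ powDomain A (β / 2)

/-- The generalized Gevrey space `𝒢_{φ,r,β}(A)`: the `u` with
`∫ x^{2β} exp(r φ(√x)) dμ_u(x) < ∞`.  If `u = ∑ u_k e_k` with `A e_k = λ_k² e_k`, the integral is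
`∑ λ_k^{4β} u_k² exp(r φ(λ_k))`. -/
def gevreySpace (A : H →ₗ.[ℝ] H) (φ : ℝ → ℝ) (r β : ℝ) : Set H :=
  {u | Integrable (fun x => x ^ (2 * β) * Real.exp (r * φ (√x))) (spectralMeasure A u)}

/-- `f ∈ C⁰([0, T]; D(A^β))`. -/
def ContinuousInto (A : H →ₗ.[ℝ] H) (β T : ℝ) (f : ℝ → H) : Prop :=
  ∀ t ∈ Icc 0 T, f t ∈ powDomain A β ∧
    Tendsto (fun s => graphNorm A β (f s - f t)) (𝓝[Icc 0 T] t) (𝓝 0)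

/-- `f ∈ C¹([0, T]; D(A^β))`, with derivative `f'` (one-sided at the end points). -/
structure ContDiffInto (A : H →ₗ.[ℝ] H) (β T : ℝ) (f f' : ℝ → H) : Prop where
  mem : ∀ t ∈ Icc 0 T, f t ∈ powDomain A β
  deriv : ∀ t ∈ Icc 0 T,
    Tendsto (fun s => graphNorm A β ((s - t)⁻¹ • (f s - f t) - f' t)) (𝓝[Icc 0 T \ {t}] t) (𝓝 0)
  continuous_deriv : ContinuousInto A β T f'

/-- `u`, with derivative `u'`, solves `u'' + m(|A^{1/2} u|²) A u = 0` on `[0, T]`.  As `u` takes its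
values in `D(A^{3/4})` only, `A u` lies in the dual of `D(A^{1/4})`, and the equation is tested
against the elements `w` of the dense subspace `D(A)`:
`d/dt ⟪u'(t), w⟫ = - m(|A^{1/2} u(t)|²) ⟪u(t), A w⟫`. -/
def SolvesKirchhoff (A : H →ₗ.[ℝ] H) (m : ℝ → ℝ) (T : ℝ) (u u' : ℝ → H) : Prop :=
  ∀ t ∈ Icc 0 T, ∀ w : A.domain,
    HasDerivWithinAt (fun s => ⟪u' s, (w : H)⟫)
      (-(m ((powNorm A (1 / 2) (u t)).toReal ^ 2) * ⟪u t, A w⟫)) (Icc 0 T) t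

end

end Kirchhoff

/-!
The theorem holds because a Kirchhoff equation can be made to look linear. Suppose a propagation
speed `c(t) ≥ 0` is prescribed, and `u` solves the linear equation `u'' + c(t) A u = 0`. If
`ψ(t) = |A^{1/2} u(t)|²` increases at a positive rate, then `c = m ∘ ψ` with `m = c ∘ ψ⁻¹`, and `m`
inherits the modulus of continuity of `c` because `ψ⁻¹` is Lipschitz. The increase of `ψ` is
produced by one low-frequency mode, the carrier, on a short time interval
(`exists_carrier`, `IsModeFamily.increase`, `exists_lipschitz_leftInverse`).

It remains to find a degenerate `ω`-continuous speed, vanishing at `t = 0`, for which the linear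
equation loses derivatives at once. Along a sequence of times `t_k = τ / 64 ^ k` decreasing to `0`,
the speed has size `δ_k` and oscillates with frequency `σ_k = √δ_k λ_{n_k}`, in resonance with the
mode of frequency `λ_{n_k}` (`isOscillator_resonant`): on an interval of length comparable with
`t_k` this mode is amplified by a factor `exp (const · σ_k t_k)`. With `δ_k` of order
`ω (1 / σ_k)` the oscillation is `ω`-continuous, and the hypothesis on `φ` says exactly that
`σ_k` dominates `φ (λ_{n_k})` (`exists_amplitude_frequency`). Therefore the mode can be exponentially
small in `φ (λ_{n_k})` at time `0` and still be of a prescribed size after `t_k`; before `t_k` the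
speed is at most `3 δ_k / 2`, so that the backward growth is at most `exp (σ_k t_k)`, which is much
less than the amplification.

After the resonance, `c` only varies by its ramp from `δ_k` up to `δ_{k-1}` and by the oscillations of
lower index. On the ramp `c` is monotone, so the energy `v² + c λ² u²` increases while
`v² / c + λ² u²` decreases; during the older oscillations both change by a factor depending only on
`σ_{k-1}` (`IsStaging.slowDecreaseAt`, `IsStaging.late_energy`). As `λ_{n_k}` is chosen after
`σ_{k-1}`, this factor is compensated by the rapid growth of the eigenvalues (`exists_isDesign`).
The first energy gives the lower bound behind the loss of derivatives at every positive time, the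
second one the uniform bound in `D(A^{3/4}) × D(A^{1/4})`. Between them there is a possible loss of
`δ_k`, at worst a negative power of `λ_{n_k}` greater than `-1`, which is why `β ≥ 1` is needed there.
At the last maximum of the resonant mode there is no such loss, which gives the blow-up for every
`β > 1/2`.

The spectral measure of `∑ a_j f_j`, with `f_j` orthonormal eigenvectors, is a sum of Dirac masses
(`isSpectralMeasure_superpose`), so all the norms involved are weighted sums of squares of the
coefficients.
-/

namespace Kirchhoff

/-! ### Superpositions of eigenvectors -/

section Superposition

variable {H : Type*} [NormedAddCommGroup H] [InnerProductSpace ℝ H]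

/-- `f` is an orthonormal sequence of eigenvectors of `A`, with eigenvalues `μ j ^ 2`, `μ j > 0`. -/
structure IsEigenSystem (A : H →ₗ.[ℝ] H) (f : ℕ → H) (μ : ℕ → ℝ) : Prop where
  orthonormal : Orthonormal ℝ f
  pos : ∀ j, 0 < μ j
  mem : ∀ j, f j ∈ A.domain
  eig : ∀ j, A ⟨f j, mem j⟩ = μ j ^ 2 • f j

/-- The vector `∑ a_j f_j`.  All coefficient sequences used below are absolutely summable. -/
noncomputable def superpose (f : ℕ → H) (a : ℕ → ℝ) : H := ∑' j, a j • f j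

variable {A : H →ₗ.[ℝ] H} {f : ℕ → H} {μ : ℕ → ℝ}

lemma summable_mul_of_abs {a b : ℕ → ℝ} (ha : Summable fun j => |a j|)
    (hb : Summable fun j => |b j|) : Summable fun j => a j * b j := by
  obtain ⟨C, hC⟩ := hb.tendsto_atTop_zero.bddAbove_range
  refine Summable.of_norm_bounded (ha.mul_right C) fun j => ?_
  rw [Real.norm_eq_abs, abs_mul]
  exact mul_le_mul_of_nonneg_left (hC ⟨j, rfl⟩) (abs_nonneg _)

lemma summable_sq_of_abs {a : ℕ → ℝ} (ha : Summable fun j => |a j|) :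
    Summable fun j => a j ^ 2 := by
  simpa only [sq] using summable_mul_of_abs ha ha

lemma norm_superpose_le (hf : Orthonormal ℝ f) {a : ℕ → ℝ} (ha : Summable fun j => |a j|) :
    ‖superpose f a‖ ≤ ∑' j, |a j| :=
  tsum_of_norm_bounded ha.hasSum fun j => by rw [norm_smul, hf.1 j, mul_one, Real.norm_eq_abs]

variable [CompleteSpace H]

lemma summable_smul (hf : Orthonormal ℝ f) {a : ℕ → ℝ} (ha : Summable fun j => |a j|) :
    Summable fun j => a j • f j :=
  Summable.of_norm <| ha.congr fun j => by rw [norm_smul, hf.1 j, mul_one, Real.norm_eq_abs]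

lemma hasSum_superpose (hf : Orthonormal ℝ f) {a : ℕ → ℝ} (ha : Summable fun j => |a j|) :
    HasSum (fun j => a j • f j) (superpose f a) :=
  (summable_smul hf ha).hasSum

lemma superpose_sub (hf : Orthonormal ℝ f) {a b : ℕ → ℝ} (ha : Summable fun j => |a j|)
    (hb : Summable fun j => |b j|) :
    superpose f (fun j => a j - b j) = superpose f a - superpose f b := by
  simpa only [superpose, sub_smul] using (summable_smul hf ha).tsum_sub (summable_smul hf hb)

lemma superpose_smul (hf : Orthonormal ℝ f) (c : ℝ) {a : ℕ → ℝ} (ha : Summable fun j => |a j|) :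
    superpose f (fun j => c * a j) = c • superpose f a := by
  simpa only [superpose, mul_smul] using (summable_smul hf ha).tsum_const_smul c

lemma hasSum_inner_superpose (hf : Orthonormal ℝ f) {a : ℕ → ℝ} (ha : Summable fun j => |a j|)
    (w : H) : HasSum (fun j => a j * ⟪f j, w⟫) ⟪superpose f a, w⟫ := by
  have h := (hasSum_superpose hf ha).mapL (innerSL ℝ w)
  simp only [innerSL_apply_apply, real_inner_smul_right] at h
  rw [real_inner_comm]
  refine h.congr_fun fun j => ?_
  rw [real_inner_comm]

lemma inner_superpose_right (hf : Orthonormal ℝ f) {a : ℕ → ℝ} (ha : Summable fun j => |a j|)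
    (j : ℕ) : ⟪f j, superpose f a⟫ = a j := by
  have h := hasSum_inner_superpose hf ha (f j)
  rw [real_inner_comm]
  refine h.unique ?_
  have h2 := hasSum_single (f := fun i => a i * ⟪f i, f j⟫) j fun i hi => by
    simp [orthonormal_iff_ite.mp hf i j, hi]
  simpa [hf.1 j] using h2

lemma inner_eig (hA : IsSelfAdjoint A) (h : IsEigenSystem A f μ) (w : A.domain)
    (j : ℕ) : ⟪f j, A w⟫ = μ j ^ 2 * ⟪f j, (w : H)⟫ := by
  have h1 := LinearPMap.adjoint_isFormalAdjoint hA.dense_domain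
  rw [LinearPMap.isSelfAdjoint_def.mp hA] at h1
  have h2 := h1 ⟨f j, h.mem j⟩ w
  rw [h.eig j, real_inner_smul_left] at h2
  exact h2.symm

/-- A superposition lies in `D(A)` as soon as the coefficients of its image are summable: the
self-adjoint `A` coincides with its adjoint. -/
lemma superpose_mem_domain (hA : IsSelfAdjoint A) (h : IsEigenSystem A f μ)
    {a : ℕ → ℝ} (ha : Summable fun j => |a j|) (ha2 : Summable fun j => |μ j ^ 2 * a j|) :
    ∃ hm : superpose f a ∈ A.domain,
      A ⟨superpose f a, hm⟩ = superpose f fun j => μ j ^ 2 * a j := by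
  have key : ∀ x : A.domain,
      ⟪superpose f (fun j => μ j ^ 2 * a j), (x : H)⟫ = ⟪superpose f a, A x⟫ := by
    intro x
    refine (hasSum_inner_superpose h.orthonormal ha2 x).unique ?_
    refine (hasSum_inner_superpose h.orthonormal ha (A x)).congr_fun fun j => ?_
    rw [inner_eig hA h]; ring
  have hA' := LinearPMap.isSelfAdjoint_def.mp hA
  have hm := LinearPMap.mem_adjoint_domain_of_exists (T := A) (superpose f a) ⟨_, key⟩
  have h3 := LinearPMap.adjoint_apply_eq hA.dense_domain ⟨superpose f a, hm⟩ key
  have h4 : ∃ hm : superpose f a ∈ A.adjoint.domain,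
      A.adjoint ⟨superpose f a, hm⟩ = superpose f fun j => μ j ^ 2 * a j := ⟨hm, h3⟩
  rwa [hA'] at h4

/-- The spectral measure of `∑ a_j f_j` is `∑ a_j² δ_{μ_j²}`. -/
noncomputable def discreteMeasure (μ a : ℕ → ℝ) : Measure ℝ :=
  Measure.sum fun j => ENNReal.ofReal (a j ^ 2) • Measure.dirac (μ j ^ 2)

lemma isFiniteMeasure_discreteMeasure {a : ℕ → ℝ} (ha : Summable fun j => |a j|) :
    IsFiniteMeasure (discreteMeasure μ a) := by
  refine ⟨?_⟩
  rw [discreteMeasure, Measure.sum_apply _ MeasurableSet.univ]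
  simpa using (summable_sq_of_abs ha).tsum_ofReal_lt_top

lemma integrable_discreteMeasure {a : ℕ → ℝ} {g : ℝ → ℝ}
    (hg : Summable fun j => a j ^ 2 * |g (μ j ^ 2)|) : Integrable g (discreteMeasure μ a) := by
  refine integrable_sum_measure (fun j => ?_) ?_
  · exact (integrable_dirac (by simp)).smul_measure (by simp)
  · refine hg.congr fun j => ?_
    rw [integral_smul_measure, integral_dirac, ENNReal.toReal_ofReal (sq_nonneg _)]
    simp

lemma isSpectralMeasure_superpose (hA : IsSelfAdjoint A)
    (h : IsEigenSystem A f μ) {a : ℕ → ℝ} (ha : Summable fun j => |a j|) :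
    IsSpectralMeasure A (superpose f a) (discreteMeasure μ a) := by
  have hpos : ∀ j, 0 < 1 + μ j ^ 2 := fun j => by positivity
  have hle : ∀ n j, |((1 + μ j ^ 2) ^ n)⁻¹ * a j| ≤ |a j| := by
    intro n j
    rw [abs_mul, abs_of_pos (inv_pos.mpr (pow_pos (hpos j) n))]
    refine mul_le_of_le_one_left (abs_nonneg _) (inv_le_one_of_one_le₀ ?_)
    exact one_le_pow₀ (by nlinarith [sq_nonneg (μ j)])
  have hs : ∀ n, Summable fun j => |((1 + μ j ^ 2) ^ n)⁻¹ * a j| := fun n =>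
    Summable.of_nonneg_of_le (fun j => abs_nonneg _) (hle n) ha
  have hid : ∀ n j, μ j ^ 2 * (((1 + μ j ^ 2) ^ (n + 1))⁻¹ * a j) =
      ((1 + μ j ^ 2) ^ n)⁻¹ * a j - ((1 + μ j ^ 2) ^ (n + 1))⁻¹ * a j := by
    intro n j
    have := (hpos j).ne'
    field_simp
    ring
  refine ⟨isFiniteMeasure_discreteMeasure ha, ?_,
    fun n => superpose f fun j => ((1 + μ j ^ 2) ^ n)⁻¹ * a j, by simp, fun n => ?_, fun n => ?_⟩
  · rw [discreteMeasure, Measure.sum_apply _ measurableSet_Iio, ENNReal.tsum_eq_zero]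
    intro j
    have : ¬ μ j ^ 2 < 0 := not_lt.mpr (sq_nonneg _)
    simp [this]
  · have hs2 : Summable fun j => |μ j ^ 2 * (((1 + μ j ^ 2) ^ (n + 1))⁻¹ * a j)| := by
      refine Summable.of_nonneg_of_le (fun j => abs_nonneg _) (fun j => ?_)
        ((hs n).add (hs (n + 1)))
      rw [hid]
      exact abs_sub _ _
    obtain ⟨hm, e⟩ := superpose_mem_domain hA h (hs (n + 1)) hs2
    refine ⟨hm, ?_⟩
    rw [e, ← superpose_sub h.orthonormal (hs n) (hs (n + 1))]
    simp only [hid]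
  · have h1 := hasSum_inner_superpose h.orthonormal (hs n) (superpose f a)
    simp only [inner_superpose_right h.orthonormal ha] at h1
    have hint : Integrable (fun x : ℝ => ((1 + x) ^ n)⁻¹) (discreteMeasure μ a) := by
      refine integrable_discreteMeasure ?_
      refine Summable.of_nonneg_of_le (fun j => by positivity) (fun j => ?_)
        (summable_sq_of_abs ha)
      rw [abs_of_pos (inv_pos.mpr (pow_pos (hpos j) n))]
      refine mul_le_of_le_one_right (sq_nonneg _) (inv_le_one_of_one_le₀ ?_)
      exact one_le_pow₀ (by nlinarith [sq_nonneg (μ j)])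
    refine h1.unique ?_
    refine (hasSum_integral_measure hint).congr_fun fun j => ?_
    rw [integral_smul_measure, integral_dirac, ENNReal.toReal_ofReal (sq_nonneg _), smul_eq_mul]
    ring

lemma spectralMeasure_superpose (hA : IsSelfAdjoint A) (hA0 : IsNonneg A)
    (h : IsEigenSystem A f μ) {a : ℕ → ℝ} (ha : Summable fun j => |a j|) :
    spectralMeasure A (superpose f a) = discreteMeasure μ a := by
  have h1 := isSpectralMeasure_superpose hA h ha
  have h2 : ∃ ν, IsSpectralMeasure A (superpose f a) ν := ⟨_, h1⟩
  rw [spectralMeasure, dif_pos h2]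
  exact IsSpectralMeasure.unique hA0 h2.choose_spec h1

lemma powNorm_superpose (hA : IsSelfAdjoint A) (hA0 : IsNonneg A)
    (h : IsEigenSystem A f μ) {a : ℕ → ℝ} (ha : Summable fun j => |a j|) (β : ℝ) :
    powNorm A β (superpose f a) =
      (∑' j, ENNReal.ofReal (a j ^ 2 * (μ j ^ 2) ^ (2 * β))) ^ (1 / 2 : ℝ) := by
  rw [powNorm, spectralMeasure_superpose hA hA0 h ha, discreteMeasure, lintegral_sum_measure]
  congr 2
  ext j
  rw [lintegral_smul_measure, lintegral_dirac, smul_eq_mul, ← ENNReal.ofReal_mul (sq_nonneg _)]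

lemma powNorm_superpose_of_summable (hA : IsSelfAdjoint A) (hA0 : IsNonneg A)
    (h : IsEigenSystem A f μ) {a : ℕ → ℝ} (ha : Summable fun j => |a j|) {β : ℝ}
    (hβ : Summable fun j => a j ^ 2 * (μ j ^ 2) ^ (2 * β)) :
    powNorm A β (superpose f a) =
      ENNReal.ofReal ((∑' j, a j ^ 2 * (μ j ^ 2) ^ (2 * β)) ^ (1 / 2 : ℝ)) := by
  have h0 : ∀ j, 0 ≤ a j ^ 2 * (μ j ^ 2) ^ (2 * β) := fun j => by positivity
  rw [powNorm_superpose hA hA0 h ha, ← ENNReal.ofReal_tsum_of_nonneg h0 hβ,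
    ENNReal.ofReal_rpow_of_nonneg (tsum_nonneg h0) (by norm_num)]

lemma superpose_mem_powDomain (hA : IsSelfAdjoint A) (hA0 : IsNonneg A)
    (h : IsEigenSystem A f μ) {a : ℕ → ℝ} (ha : Summable fun j => |a j|) {β : ℝ}
    (hβ : Summable fun j => a j ^ 2 * (μ j ^ 2) ^ (2 * β)) :
    superpose f a ∈ powDomain A β := by
  change powNorm A β _ < ∞
  rw [powNorm_superpose_of_summable hA hA0 h ha hβ]
  exact ENNReal.ofReal_lt_top

lemma summable_of_superpose_mem_powDomain (hA : IsSelfAdjoint A) (hA0 : IsNonneg A)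
    (h : IsEigenSystem A f μ) {a : ℕ → ℝ} (ha : Summable fun j => |a j|)
    {β : ℝ} (hβ : superpose f a ∈ powDomain A β) :
    Summable fun j => a j ^ 2 * (μ j ^ 2) ^ (2 * β) := by
  have h0 : ∀ j, 0 ≤ a j ^ 2 * (μ j ^ 2) ^ (2 * β) := fun j => by positivity
  change powNorm A β _ < ∞ at hβ
  rw [powNorm_superpose hA hA0 h ha, ENNReal.rpow_lt_top_iff_of_pos (by norm_num)] at hβ
  refine (ENNReal.summable_toReal hβ.ne).congr fun j => ?_
  rw [ENNReal.toReal_ofReal (h0 j)]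

lemma le_powNorm_superpose (hA : IsSelfAdjoint A) (hA0 : IsNonneg A)
    (h : IsEigenSystem A f μ) {a : ℕ → ℝ} (ha : Summable fun j => |a j|) (β : ℝ) (j : ℕ) :
    ENNReal.ofReal (a j ^ 2 * (μ j ^ 2) ^ (2 * β)) ^ (1 / 2 : ℝ) ≤
      powNorm A β (superpose f a) := by
  rw [powNorm_superpose hA hA0 h ha]
  exact ENNReal.rpow_le_rpow (ENNReal.le_tsum j) (by norm_num)

lemma tendsto_graphNorm_superpose (hA : IsSelfAdjoint A) (hA0 : IsNonneg A)
    (h : IsEigenSystem A f μ) {ι : Type*} {l : Filter ι} {a : ι → ℕ → ℝ} {D : ℕ → ℝ} {β : ℝ}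
    (hD : Summable D) (hDβ : Summable fun j => D j ^ 2 * (μ j ^ 2) ^ (2 * β))
    (hb : ∀ᶠ s in l, ∀ j, |a s j| ≤ D j) (hlim : ∀ j, Tendsto (fun s => a s j) l (𝓝 0)) :
    Tendsto (fun s => graphNorm A β (superpose f (a s))) l (𝓝 0) := by
  have T1 : Tendsto (fun s => ∑' j, |a s j|) l (𝓝 0) := by
    have := tendsto_tsum_of_dominated_convergence (f := fun s j => |a s j|) (g := fun _ => (0 : ℝ))
      (𝓕 := l) hD (fun j => by simpa using (hlim j).abs)
      (hb.mono fun s hs j => by simpa using hs j)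
    simpa using this
  have T2 : Tendsto (fun s => ∑' j, a s j ^ 2 * (μ j ^ 2) ^ (2 * β)) l (𝓝 0) := by
    have := tendsto_tsum_of_dominated_convergence
      (f := fun s j => a s j ^ 2 * (μ j ^ 2) ^ (2 * β)) (g := fun _ => (0 : ℝ))
      (𝓕 := l) hDβ (fun j => by simpa using ((hlim j).pow 2).mul_const _)
      (hb.mono fun s hs j => by
        rw [Real.norm_eq_abs, abs_of_nonneg (by positivity)]
        refine mul_le_mul_of_nonneg_right ?_ (by positivity)
        rw [← sq_abs]
        exact pow_le_pow_left₀ (abs_nonneg _) (hs j) 2)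
    simpa using this
  have T3 : Tendsto (fun s => ENNReal.ofReal (∑' j, |a s j|) + ENNReal.ofReal
      ((∑' j, a s j ^ 2 * (μ j ^ 2) ^ (2 * β)) ^ (1 / 2 : ℝ))) l (𝓝 0) := by
    have e2 := T2.rpow_const (p := (1 / 2 : ℝ)) (Or.inr (by norm_num))
    rw [Real.zero_rpow (by norm_num)] at e2
    simpa using (ENNReal.tendsto_ofReal T1).add (ENNReal.tendsto_ofReal e2)
  refine tendsto_of_tendsto_of_tendsto_of_le_of_le' tendsto_const_nhds T3
    (Eventually.of_forall fun _ => zero_le) (hb.mono fun s hs => ?_)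
  have ha : Summable fun j => |a s j| :=
    Summable.of_nonneg_of_le (fun j => abs_nonneg _) hs hD
  have haβ : Summable fun j => a s j ^ 2 * (μ j ^ 2) ^ (2 * β) := by
    refine Summable.of_nonneg_of_le (fun j => by positivity) (fun j => ?_) hDβ
    refine mul_le_mul_of_nonneg_right ?_ (by positivity)
    rw [← sq_abs]
    exact pow_le_pow_left₀ (abs_nonneg _) (hs j) 2
  rw [graphNorm, powNorm_superpose_of_summable hA hA0 h ha haβ]
  gcongr
  rw [← ofReal_norm]
  exact ENNReal.ofReal_le_ofReal (norm_superpose_le h.orthonormal ha)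

lemma superpose_mem_gevreySpace (hA : IsSelfAdjoint A) (hA0 : IsNonneg A)
    (h : IsEigenSystem A f μ) {a : ℕ → ℝ} (ha : Summable fun j => |a j|) {φ : ℝ → ℝ} {r β : ℝ}
    (hs : Summable fun j => a j ^ 2 * (μ j ^ 2) ^ (2 * β) * Real.exp (r * φ (μ j))) :
    superpose f a ∈ gevreySpace A φ r β := by
  change Integrable _ _
  rw [spectralMeasure_superpose hA hA0 h ha]
  refine integrable_discreteMeasure (hs.congr fun j => ?_)
  rw [abs_of_nonneg (by positivity), Real.sqrt_sq (h.pos j).le, mul_assoc]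

/-! ### Series with time-dependent coefficients -/

variable {T : ℝ}

lemma continuousInto_superpose (hA : IsSelfAdjoint A) (hA0 : IsNonneg A)
    (h : IsEigenSystem A f μ) {V : ℕ → ℝ → ℝ} {D : ℕ → ℝ} {β : ℝ} (hD : Summable D)
    (hDβ : Summable fun j => D j ^ 2 * (μ j ^ 2) ^ (2 * β))
    (hV : ∀ j, ContinuousOn (V j) (Icc 0 T)) (hb : ∀ j, ∀ t ∈ Icc 0 T, |V j t| ≤ D j) :
    ContinuousInto A β T fun t => superpose f fun j => V j t := by
  have hs : ∀ t ∈ Icc 0 T, Summable fun j => |V j t| := fun t ht =>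
    Summable.of_nonneg_of_le (fun j => abs_nonneg _) (fun j => hb j t ht) hD
  intro t ht
  refine ⟨superpose_mem_powDomain hA hA0 h (hs t ht) ?_, ?_⟩
  · refine Summable.of_nonneg_of_le (fun j => by positivity) (fun j => ?_) hDβ
    refine mul_le_mul_of_nonneg_right ?_ (by positivity)
    rw [← sq_abs]
    exact pow_le_pow_left₀ (abs_nonneg _) (hb j t ht) 2
  · have key := tendsto_graphNorm_superpose hA hA0 h (l := 𝓝[Icc 0 T] t)
      (a := fun s j => V j s - V j t) (D := fun j => 2 * D j) (β := β) (hD.mul_left 2)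
      ((hDβ.mul_left 4).congr fun j => by ring) ?_ fun j => ?_
    · refine key.congr' ?_
      filter_upwards [self_mem_nhdsWithin] with s hs'
      rw [superpose_sub h.orthonormal (hs s hs') (hs t ht)]
    · filter_upwards [self_mem_nhdsWithin] with s hs' j
      have := abs_sub (V j s) (V j t)
      linarith [hb j s hs', hb j t ht]
    · have : Tendsto (fun s => V j s - V j t) (𝓝[Icc 0 T] t) (𝓝 (V j t - V j t)) :=
        (hV j t ht).sub_const _
      simpa using this

lemma abs_sub_le_of_hasDerivWithinAt {v v' : ℝ → ℝ} {C : ℝ}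
    (hv : ∀ t ∈ Icc 0 T, HasDerivWithinAt v (v' t) (Icc 0 T) t)
    (hb : ∀ t ∈ Icc 0 T, |v' t| ≤ C) {s t : ℝ} (hs : s ∈ Icc 0 T) (ht : t ∈ Icc 0 T) :
    |v s - v t| ≤ C * |s - t| := by
  simpa using Convex.norm_image_sub_le_of_norm_hasDerivWithin_le hv
    (fun x hx => by simpa using hb x hx) (convex_Icc 0 T) ht hs

lemma abs_quotient_le {v v' : ℝ → ℝ} {C : ℝ}
    (hv : ∀ t ∈ Icc 0 T, HasDerivWithinAt v (v' t) (Icc 0 T) t)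
    (hb : ∀ t ∈ Icc 0 T, |v' t| ≤ C) {s t : ℝ} (hs : s ∈ Icc 0 T \ {t}) (ht : t ∈ Icc 0 T) :
    |(s - t)⁻¹ * (v s - v t)| ≤ C := by
  have h1 := abs_sub_le_of_hasDerivWithinAt hv hb hs.1 ht
  have h2 : 0 < |s - t| := abs_pos.mpr (sub_ne_zero.mpr fun h => hs.2 h)
  rw [abs_mul, abs_inv, inv_mul_le_iff₀ h2]
  linarith

lemma tendsto_quotient {v v' : ℝ → ℝ}
    (hv : ∀ t ∈ Icc 0 T, HasDerivWithinAt v (v' t) (Icc 0 T) t) {t : ℝ} (ht : t ∈ Icc 0 T) :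
    Tendsto (fun s => (s - t)⁻¹ * (v s - v t)) (𝓝[Icc 0 T \ {t}] t) (𝓝 (v' t)) := by
  have := hasDerivWithinAt_iff_tendsto_slope.mp (hv t ht)
  simpa only [slope_fun_def, vsub_eq_sub, smul_eq_mul] using this

lemma contDiffInto_superpose (hA : IsSelfAdjoint A) (hA0 : IsNonneg A)
    (h : IsEigenSystem A f μ) {V V' : ℕ → ℝ → ℝ} {C D : ℕ → ℝ} {β : ℝ} (hC : Summable C)
    (hCβ : Summable fun j => C j ^ 2 * (μ j ^ 2) ^ (2 * β)) (hD : Summable D)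
    (hDβ : Summable fun j => D j ^ 2 * (μ j ^ 2) ^ (2 * β))
    (hV : ∀ j, ∀ t ∈ Icc 0 T, HasDerivWithinAt (V j) (V' j t) (Icc 0 T) t)
    (hV' : ∀ j, ContinuousOn (V' j) (Icc 0 T)) (hb : ∀ j, ∀ t ∈ Icc 0 T, |V j t| ≤ C j)
    (hb' : ∀ j, ∀ t ∈ Icc 0 T, |V' j t| ≤ D j) :
    ContDiffInto A β T (fun t => superpose f fun j => V j t)
      (fun t => superpose f fun j => V' j t) := by
  have hs : ∀ t ∈ Icc 0 T, Summable fun j => |V j t| := fun t ht =>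
    Summable.of_nonneg_of_le (fun j => abs_nonneg _) (fun j => hb j t ht) hC
  have hs' : ∀ t ∈ Icc 0 T, Summable fun j => |V' j t| := fun t ht =>
    Summable.of_nonneg_of_le (fun j => abs_nonneg _) (fun j => hb' j t ht) hD
  refine ⟨fun t ht => ((continuousInto_superpose hA hA0 h hC hCβ
    (fun j s hs => (hV j s hs).continuousWithinAt) hb) t ht).1, fun t ht => ?_,
    continuousInto_superpose hA hA0 h hD hDβ hV' hb'⟩
  have key := tendsto_graphNorm_superpose hA hA0 h (l := 𝓝[Icc 0 T \ {t}] t)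
    (a := fun s j => (s - t)⁻¹ * (V j s - V j t) - V' j t) (D := fun j => 2 * D j) (β := β)
    (hD.mul_left 2) ((hDβ.mul_left 4).congr fun j => by ring) ?_ fun j => ?_
  · refine key.congr' ?_
    filter_upwards [self_mem_nhdsWithin] with s hst
    have h1 : Summable fun j => |V j s - V j t| :=
      Summable.of_nonneg_of_le (fun j => abs_nonneg _) (fun j => abs_sub _ _)
        ((hs s hst.1).add (hs t ht))
    rw [superpose_sub h.orthonormal _ (hs' t ht), superpose_smul h.orthonormal _ h1,
      superpose_sub h.orthonormal (hs s hst.1) (hs t ht)]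
    simpa only [abs_mul] using h1.mul_left _
  · filter_upwards [self_mem_nhdsWithin] with s hst j
    have := abs_sub ((s - t)⁻¹ * (V j s - V j t)) (V' j t)
    linarith [abs_quotient_le (hV j) (hb' j) hst ht, hb' j t ht]
  · simpa using (tendsto_quotient (hV j) ht).sub_const (V' j t)

/-- If every coefficient solves `V'' = - c μ² V`, the superposition solves the equation weakly. -/
lemma hasDerivWithinAt_inner_superpose (hA : IsSelfAdjoint A)
    (h : IsEigenSystem A f μ) {V V' : ℕ → ℝ → ℝ} {c : ℝ → ℝ} {C D : ℕ → ℝ} {M : ℝ}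
    (hC : Summable C) (hD : Summable D) (hc : ∀ t ∈ Icc 0 T, |c t| ≤ M)
    (hV' : ∀ j, ∀ t ∈ Icc 0 T,
      HasDerivWithinAt (V' j) (-(c t * μ j ^ 2 * V j t)) (Icc 0 T) t)
    (hb : ∀ j, ∀ t ∈ Icc 0 T, |V j t| ≤ C j) (hb' : ∀ j, ∀ t ∈ Icc 0 T, |V' j t| ≤ D j)
    {t : ℝ} (ht : t ∈ Icc 0 T) (w : A.domain) :
    HasDerivWithinAt (fun s => ⟪superpose f (fun j => V' j s), (w : H)⟫)
      (-(c t * ⟪superpose f (fun j => V j t), A w⟫)) (Icc 0 T) t := by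
  have hs : Summable fun j => |V j t| :=
    Summable.of_nonneg_of_le (fun j => abs_nonneg _) (fun j => hb j t ht) hC
  have hs' : ∀ t ∈ Icc 0 T, Summable fun j => |V' j t| := fun t ht =>
    Summable.of_nonneg_of_le (fun j => abs_nonneg _) (fun j => hb' j t ht) hD
  have hM : 0 ≤ M := (abs_nonneg _).trans (hc t ht)
  have hlim : -(c t * ⟪superpose f (fun j => V j t), A w⟫) =
      ∑' j, -(c t * μ j ^ 2 * V j t) * ⟪f j, (w : H)⟫ := by
    have h1 := ((hasSum_inner_superpose h.orthonormal hs (A w)).mul_left (c t)).neg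
    rw [← h1.tsum_eq]
    congr 1
    ext j
    rw [inner_eig hA h]
    ring
  rw [hlim, hasDerivWithinAt_iff_tendsto_slope]
  have key := tendsto_tsum_of_dominated_convergence (𝓕 := 𝓝[Icc 0 T \ {t}] t)
    (f := fun s j => (s - t)⁻¹ * (V' j s - V' j t) * ⟪f j, (w : H)⟫)
    (g := fun j => -(c t * μ j ^ 2 * V j t) * ⟪f j, (w : H)⟫)
    (bound := fun j => M * C j * ‖A w‖) ((hC.mul_left M).mul_right _)
    (fun j => (tendsto_quotient (hV' j) ht).mul_const _) ?_
  · refine key.congr' ?_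
    filter_upwards [self_mem_nhdsWithin] with s hst
    have h1 := ((hasSum_inner_superpose h.orthonormal (hs' s hst.1) (w : H)).sub
      (hasSum_inner_superpose h.orthonormal (hs' t ht) (w : H))).mul_left (s - t)⁻¹
    rw [slope_def_field, div_eq_inv_mul, ← h1.tsum_eq]
    congr 1
    ext j
    ring
  · filter_upwards [self_mem_nhdsWithin] with s hst j
    have h1 := abs_quotient_le (C := M * C j * μ j ^ 2) (hV' j) (fun x hx => by
      rw [abs_neg, abs_mul, abs_mul, abs_of_nonneg (sq_nonneg (μ j))]
      have := mul_le_mul (hc x hx) (hb j x hx) (abs_nonneg _) hM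
      nlinarith [sq_nonneg (μ j)]) hst ht
    have h2 : μ j ^ 2 * |⟪f j, (w : H)⟫| ≤ ‖A w‖ := by
      have h3 := abs_real_inner_le_norm (f j) (A w)
      rwa [h.orthonormal.1 j, one_mul, inner_eig hA h, abs_mul,
        abs_of_nonneg (sq_nonneg (μ j))] at h3
    have hC0 : 0 ≤ C j := (abs_nonneg _).trans (hb j t ht)
    rw [Real.norm_eq_abs, abs_mul]
    calc _ ≤ M * C j * μ j ^ 2 * |⟪f j, (w : H)⟫| :=
          mul_le_mul_of_nonneg_right h1 (abs_nonneg _)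
      _ = M * C j * (μ j ^ 2 * |⟪f j, (w : H)⟫|) := by ring
      _ ≤ _ := mul_le_mul_of_nonneg_left h2 (by positivity)

end Superposition

/-! ### Global solutions of linear differential equations -/

section LinearODE

lemma abs_integral_exp_mul_abs_le {Λ : ℝ} (hΛ : 0 < Λ) (t₀ t : ℝ) :
    |∫ s in t₀..t, Real.exp (Λ * |s - t₀|)| ≤ Real.exp (Λ * |t - t₀|) / Λ := by
  have key : ∀ r : ℝ, 0 ≤ r →
      |∫ s in (0 : ℝ)..r, Real.exp (Λ * |s|)| ≤ Real.exp (Λ * r) / Λ := by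
    intro r hr
    have h1 : ∫ s in (0 : ℝ)..r, Real.exp (Λ * |s|) = ∫ s in (0 : ℝ)..r, Real.exp (Λ * s) := by
      refine intervalIntegral.integral_congr fun s hs => ?_
      rw [uIcc_of_le hr] at hs
      simp only [abs_of_nonneg hs.1]
    have h2 : ∫ s in (0 : ℝ)..r, Real.exp (Λ * s) =
        Real.exp (Λ * r) / Λ - Real.exp (Λ * 0) / Λ := by
      refine intervalIntegral.integral_eq_sub_of_hasDerivAt (f := fun s => Real.exp (Λ * s) / Λ)
        (fun s _ => ?_) (Continuous.intervalIntegrable (by fun_prop) _ _)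
      have := (((hasDerivAt_id s).const_mul Λ).exp).div_const Λ
      simpa [hΛ.ne'] using this
    have h3 : (1 : ℝ) ≤ Real.exp (Λ * r) := Real.one_le_exp (by positivity)
    rw [h1, h2, mul_zero, Real.exp_zero, ← sub_div, abs_of_nonneg (by
      apply div_nonneg <;> linarith)]
    gcongr
    linarith
  have hshift : ∫ s in t₀..t, Real.exp (Λ * |s - t₀|) =
      ∫ s in (0 : ℝ)..(t - t₀), Real.exp (Λ * |s|) := by
    simpa using intervalIntegral.integral_comp_sub_right
      (fun s => Real.exp (Λ * |s|)) (a := t₀) (b := t) t₀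
  rw [hshift]
  rcases le_total 0 (t - t₀) with h | h
  · simpa only [abs_of_nonneg h] using key _ h
  · have hneg : ∫ s in (0 : ℝ)..(t - t₀), Real.exp (Λ * |s|) =
        - ∫ s in (0 : ℝ)..(-(t - t₀)), Real.exp (Λ * |s|) := by
      have := intervalIntegral.integral_comp_neg (fun s => Real.exp (Λ * |s|))
        (a := (0 : ℝ)) (b := t - t₀)
      simp only [abs_neg, neg_zero] at this
      rw [this, ← intervalIntegral.integral_symm]
    rw [hneg, abs_neg, abs_of_nonpos h]
    exact key _ (by linarith)

/-- A linear equation `x' = B(t) x` with bounded continuous `B` has a solution on the whole line.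
The Picard operator is a contraction for the weighted norm `sup e^{-Λ|t - t₀|} ‖x(t)‖`. -/
lemma exists_global_linear_ode {E : Type*} [NormedAddCommGroup E] [NormedSpace ℝ E]
    [CompleteSpace E] {B : ℝ → E →L[ℝ] E} (hB : Continuous B) {M : ℝ} (hM : ∀ t, ‖B t‖ ≤ M)
    (t₀ : ℝ) (x₀ : E) :
    ∃ x : ℝ → E, x t₀ = x₀ ∧ ∀ t, HasDerivAt x (B t (x t)) t := by
  have hM0 : 0 ≤ M := (norm_nonneg _).trans (hM 0)
  set Λ : ℝ := 2 * (M + 1) with hΛdef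
  have hΛ : 0 < Λ := by positivity
  set W : ℝ → ℝ := fun s => Real.exp (Λ * |s - t₀|) with hW
  have hWc : Continuous W := by fun_prop
  have hWpos : ∀ s, 0 < W s := fun s => Real.exp_pos _
  have hW1 : ∀ s, 1 ≤ W s := fun s => Real.one_le_exp (by positivity)
  have hgc : ∀ α : BoundedContinuousFunction ℝ E, Continuous fun s => W s • B s (α s) :=
    fun α => hWc.smul (hB.clm_apply α.continuous)
  have hbd : ∀ (α : BoundedContinuousFunction ℝ E) (t : ℝ),
      ‖∫ s in t₀..t, W s • B s (α s)‖ ≤ M * ‖α‖ * (W t / Λ) := by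
    intro α t
    have h1 : ∀ s, ‖W s • B s (α s)‖ ≤ M * ‖α‖ * W s := by
      intro s
      rw [norm_smul, Real.norm_eq_abs, abs_of_pos (hWpos s)]
      have h2 : ‖B s (α s)‖ ≤ M * ‖α‖ :=
        ((B s).le_opNorm _).trans (mul_le_mul (hM s) (α.norm_coe_le_norm s) (norm_nonneg _) hM0)
      nlinarith [hWpos s]
    have h3 := intervalIntegral.norm_integral_le_abs_of_norm_le (μ := volume) (a := t₀) (b := t)
      (f := fun s => W s • B s (α s)) (g := fun s => M * ‖α‖ * W s)
      (Eventually.of_forall fun s => h1 s) (Continuous.intervalIntegrable (by fun_prop) _ _)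
    refine h3.trans ?_
    rw [intervalIntegral.integral_const_mul, abs_mul, abs_of_nonneg (by positivity)]
    exact mul_le_mul_of_nonneg_left (abs_integral_exp_mul_abs_le hΛ t₀ t) (by positivity)
  have hcont : ∀ α : BoundedContinuousFunction ℝ E,
      Continuous fun t => (W t)⁻¹ • (x₀ + ∫ s in t₀..t, W s • B s (α s)) := by
    intro α
    refine (hWc.inv₀ fun s => (hWpos s).ne').smul (continuous_const.add ?_)
    exact intervalIntegral.continuous_primitive
      (fun a b => (hgc α).intervalIntegrable a b) t₀
  let Φ : BoundedContinuousFunction ℝ E → BoundedContinuousFunction ℝ E := fun α =>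
    BoundedContinuousFunction.ofNormedAddCommGroup
      (fun t => (W t)⁻¹ • (x₀ + ∫ s in t₀..t, W s • B s (α s))) (hcont α)
      (‖x₀‖ + M * ‖α‖ * (1 / Λ)) (by
        intro t
        rw [norm_smul, norm_inv, Real.norm_eq_abs, abs_of_pos (hWpos t),
          inv_mul_le_iff₀ (hWpos t)]
        have h1 := norm_add_le x₀ (∫ s in t₀..t, W s • B s (α s))
        have h2 := hbd α t
        have h3 := mul_le_mul_of_nonneg_right (hW1 t) (norm_nonneg x₀)
        have h4 : M * ‖α‖ * (W t / Λ) = W t * (M * ‖α‖ * (1 / Λ)) := by ring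
        rw [mul_add]
        linarith)
  have hΦ : ∀ α t, Φ α t = (W t)⁻¹ • (x₀ + ∫ s in t₀..t, W s • B s (α s)) := fun _ _ => rfl
  have hcontr : ContractingWith (1 / 2 : ℝ≥0) Φ := by
    refine ⟨by norm_num, LipschitzWith.of_dist_le_mul fun α β => ?_⟩
    rw [dist_eq_norm, dist_eq_norm,
      BoundedContinuousFunction.norm_le (by positivity)]
    intro t
    have h1 : (Φ α - Φ β) t = (W t)⁻¹ • ∫ s in t₀..t, W s • B s ((α - β) s) := by
      rw [BoundedContinuousFunction.sub_apply, hΦ, hΦ, ← smul_sub, add_sub_add_left_eq_sub,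
        ← intervalIntegral.integral_sub ((hgc α).intervalIntegrable _ _)
          ((hgc β).intervalIntegrable _ _)]
      simp only [BoundedContinuousFunction.sub_apply, map_sub, smul_sub]
    rw [h1, norm_smul, norm_inv, Real.norm_eq_abs, abs_of_pos (hWpos t),
      inv_mul_le_iff₀ (hWpos t)]
    refine (hbd (α - β) t).trans ?_
    have h2 : M / Λ ≤ 1 / 2 := by
      rw [div_le_div_iff₀ hΛ (by norm_num), hΛdef]; linarith
    have h3 : M * ‖α - β‖ * (W t / Λ) = W t * (M / Λ * ‖α - β‖) := by ring
    rw [h3]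
    push_cast
    have := hWpos t
    gcongr
  set α := hcontr.fixedPoint Φ with hα
  have hfix : Φ α = α := hcontr.fixedPoint_isFixedPt
  have hval : ∀ t, W t • α t = x₀ + ∫ s in t₀..t, W s • B s (α s) := by
    intro t
    conv_lhs => rw [← hfix, hΦ]
    rw [smul_inv_smul₀ (hWpos t).ne']
  refine ⟨fun t => W t • α t, ?_, fun t => ?_⟩
  · simp [hval]
  · have h1 : HasDerivAt (fun t => x₀ + ∫ s in t₀..t, W s • B s (α s)) (W t • B t (α t)) t :=
      (intervalIntegral.integral_hasDerivAt_right ((hgc α).intervalIntegrable _ _)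
        ((hgc α).stronglyMeasurableAtFilter _ _) (hgc α).continuousAt).const_add x₀
    rw [map_smul]
    exact h1.congr_of_eventuallyEq (Eventually.of_forall hval)

/-- The field `(u, v) ↦ (v, - a u)` of the oscillator `u'' + a u = 0`. -/
noncomputable def oscillatorField (a : ℝ) : ℝ × ℝ →L[ℝ] ℝ × ℝ :=
  (ContinuousLinearMap.snd ℝ ℝ ℝ).prod 0 - a • (0 : ℝ × ℝ →L[ℝ] ℝ).prod (.fst ℝ ℝ ℝ)

lemma oscillatorField_apply (a : ℝ) (x : ℝ × ℝ) : oscillatorField a x = (x.2, -(a * x.1)) := by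
  simp [oscillatorField]

lemma norm_oscillatorField_le (a : ℝ) : ‖oscillatorField a‖ ≤ 1 + |a| := by
  refine ContinuousLinearMap.opNorm_le_bound _ (by positivity) fun x => ?_
  have h1 := norm_fst_le x
  have h2 := norm_snd_le x
  have h3 := abs_nonneg a
  have h4 := norm_nonneg x
  rw [oscillatorField_apply, Prod.norm_def, max_le_iff]
  constructor
  · show ‖x.2‖ ≤ _
    nlinarith
  · show ‖-(a * x.1)‖ ≤ _
    rw [norm_neg, norm_mul, Real.norm_eq_abs]
    nlinarith

/-- `u` and `v` are defined on the whole line, `u' = v` and `v' = - a(t) u`. -/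
structure IsOscillator (a u v : ℝ → ℝ) : Prop where
  deriv_pos : ∀ t, HasDerivAt u (v t) t
  deriv_vel : ∀ t, HasDerivAt v (-(a t * u t)) t

lemma IsOscillator.continuous_pos {a u v : ℝ → ℝ} (h : IsOscillator a u v) : Continuous u :=
  continuous_iff_continuousAt.mpr fun t => (h.deriv_pos t).continuousAt

lemma IsOscillator.continuous_vel {a u v : ℝ → ℝ} (h : IsOscillator a u v) : Continuous v :=
  continuous_iff_continuousAt.mpr fun t => (h.deriv_vel t).continuousAt

lemma exists_isOscillator {a : ℝ → ℝ} (ha : Continuous a) {M : ℝ} (hM : ∀ t, |a t| ≤ M)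
    (t₀ u₀ v₀ : ℝ) : ∃ u v, IsOscillator a u v ∧ u t₀ = u₀ ∧ v t₀ = v₀ := by
  have hB : Continuous fun t => oscillatorField (a t) :=
    continuous_const.sub (ha.smul continuous_const)
  obtain ⟨x, hx0, hx⟩ := exists_global_linear_ode hB (M := 1 + M)
    (fun t => (norm_oscillatorField_le _).trans (by linarith [hM t])) t₀ (u₀, v₀)
  refine ⟨fun t => (x t).1, fun t => (x t).2, ⟨fun t => ?_, fun t => ?_⟩, by simp [hx0],
    by simp [hx0]⟩
  · have := (hx t).fst
    rwa [oscillatorField_apply] at this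
  · have := (hx t).snd
    rwa [oscillatorField_apply] at this

/-- Two-sided energy estimate: if `|ν² - a| ≤ ν Λ` then `v² + ν² u²` varies by a factor at most
`e^{Λ|t - s|}`, in both time directions. -/
lemma IsOscillator.energy_le {a u v : ℝ → ℝ} (h : IsOscillator a u v) {ν Λ : ℝ} (hν : 0 < ν)
    {l r : ℝ} (ha : ∀ t ∈ Icc l r, |ν ^ 2 - a t| ≤ ν * Λ) {s t : ℝ} (hs : s ∈ Icc l r)
    (ht : t ∈ Icc l r) :
    v t ^ 2 + ν ^ 2 * u t ^ 2 ≤ (v s ^ 2 + ν ^ 2 * u s ^ 2) * Real.exp (Λ * |t - s|) := by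
  set F : ℝ → ℝ := fun x => v x ^ 2 + ν ^ 2 * u x ^ 2 with hF
  have hF' : ∀ x, HasDerivAt F (2 * (ν ^ 2 - a x) * (u x * v x)) x := by
    intro x
    have := ((h.deriv_vel x).pow 2).add (((h.deriv_pos x).pow 2).const_mul (ν ^ 2))
    refine this.congr_deriv ?_
    simp
    ring
  have hFb : ∀ x ∈ Icc l r, |2 * (ν ^ 2 - a x) * (u x * v x)| ≤ Λ * F x := by
    intro x hx
    have h1 := ha x hx
    have h2 : 2 * ν * |u x * v x| ≤ F x := by
      rw [abs_mul]
      have := sq_nonneg (|v x| - ν * |u x|)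
      rw [hF]
      nlinarith [sq_abs (u x), sq_abs (v x)]
    have hΛ : 0 ≤ Λ := by
      by_contra hneg
      nlinarith [abs_nonneg (ν ^ 2 - a x)]
    calc |2 * (ν ^ 2 - a x) * (u x * v x)| = 2 * |ν ^ 2 - a x| * |u x * v x| := by
          rw [abs_mul, abs_mul, abs_two]
      _ ≤ 2 * (ν * Λ) * |u x * v x| := by gcongr
      _ = Λ * (2 * ν * |u x * v x|) := by ring
      _ ≤ Λ * F x := by gcongr
  have up : ∀ x ∈ Icc l r, ∀ y ∈ Icc l r, x ≤ y → F y ≤ F x * Real.exp (Λ * (y - x)) ∧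
      F x ≤ F y * Real.exp (Λ * (y - x)) := by
    intro x hx y hy hxy
    have sub : ∀ z ∈ Icc x y, z ∈ Icc l r := fun z hz => ⟨hx.1.trans hz.1, hz.2.trans hy.2⟩
    constructor
    · have mono : AntitoneOn (fun z => F z * Real.exp (-Λ * (z - x))) (Icc x y) := by
        refine antitoneOn_of_hasDerivWithinAt_nonpos (convex_Icc x y) ?_
          (f' := fun z => 2 * (ν ^ 2 - a z) * (u z * v z) * Real.exp (-Λ * (z - x)) +
            F z * (Real.exp (-Λ * (z - x)) * -Λ)) ?_ ?_
        · have : Continuous F := continuous_iff_continuousAt.mpr fun z => (hF' z).continuousAt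
          fun_prop
        · intro z _
          refine ((hF' z).mul ?_).hasDerivWithinAt
          have := ((((hasDerivAt_id z).sub_const x)).const_mul (-Λ)).exp
          simpa using this
        · intro z hz
          rw [interior_Icc] at hz
          have h1 := le_of_abs_le (hFb z (sub z ⟨hz.1.le, hz.2.le⟩))
          have h2 := Real.exp_pos (-Λ * (z - x))
          nlinarith
      have := mono (left_mem_Icc.mpr hxy) (right_mem_Icc.mpr hxy) hxy
      simp only [sub_self, mul_zero, Real.exp_zero, mul_one] at this
      calc F y = F y * Real.exp (-Λ * (y - x)) * Real.exp (Λ * (y - x)) := by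
            rw [mul_assoc, ← Real.exp_add]; simp
        _ ≤ _ := mul_le_mul_of_nonneg_right this (Real.exp_pos _).le
    · have mono : MonotoneOn (fun z => F z * Real.exp (Λ * (z - x))) (Icc x y) := by
        refine monotoneOn_of_hasDerivWithinAt_nonneg (convex_Icc x y) ?_
          (f' := fun z => 2 * (ν ^ 2 - a z) * (u z * v z) * Real.exp (Λ * (z - x)) +
            F z * (Real.exp (Λ * (z - x)) * Λ)) ?_ ?_
        · have : Continuous F := continuous_iff_continuousAt.mpr fun z => (hF' z).continuousAt
          fun_prop
        · intro z _
          refine ((hF' z).mul ?_).hasDerivWithinAt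
          have := ((((hasDerivAt_id z).sub_const x)).const_mul Λ).exp
          simpa using this
        · intro z hz
          rw [interior_Icc] at hz
          have h1 := neg_le_of_abs_le (hFb z (sub z ⟨hz.1.le, hz.2.le⟩))
          have h2 := Real.exp_pos (Λ * (z - x))
          nlinarith
      have := mono (left_mem_Icc.mpr hxy) (right_mem_Icc.mpr hxy) hxy
      simpa only [sub_self, mul_zero, Real.exp_zero, mul_one] using this
  rcases le_total s t with hst | hst
  · rw [abs_of_nonneg (sub_nonneg.mpr hst)]
    exact (up s hs t ht hst).1
  · rw [abs_of_nonpos (sub_nonpos.mpr hst), neg_sub]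
    exact (up t ht s hs hst).2

end LinearODE

/-! ### Energy estimates for speeds of one-sided regularity -/

section OneSided

lemma IsOscillator.eqOn {a a' u v u' v' : ℝ → ℝ} (h : IsOscillator a u v)
    (h' : IsOscillator a' u' v') {M : ℝ} (hM : ∀ t, |a t| ≤ M) {l r : ℝ}
    (heq : ∀ t ∈ Icc l r, a t = a' t) (hu : u l = u' l) (hv : v l = v' l) :
    ∀ t ∈ Icc l r, u t = u' t ∧ v t = v' t := by
  have hM0 : 0 ≤ M := (abs_nonneg _).trans (hM 0)
  have key := ODE_solution_unique (v := fun t x => oscillatorField (a t) x)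
    (f := fun t => (u t, v t)) (g := fun t => (u' t, v' t)) (K := (1 + M).toNNReal)
    (a := l) (b := r)
    (fun t => (oscillatorField (a t)).lipschitz.weaken
      ((Real.le_toNNReal_iff_coe_le (by positivity)).mpr
        ((norm_oscillatorField_le _).trans (by linarith [hM t]))))
    (h.continuous_pos.prodMk h.continuous_vel).continuousOn
    (fun t _ => by
      rw [oscillatorField_apply]
      exact ((h.deriv_pos t).prodMk (h.deriv_vel t)).hasDerivWithinAt)
    (h'.continuous_pos.prodMk h'.continuous_vel).continuousOn
    (fun t ht => by
      rw [oscillatorField_apply, heq t ⟨ht.1, ht.2.le⟩]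
      exact ((h'.deriv_pos t).prodMk (h'.deriv_vel t)).hasDerivWithinAt)
    (by simp [hu, hv])
  intro t ht
  exact Prod.ext_iff.mp (key ht)

/-- The relative rate of decrease of `c` to the right of `x` is at most `K`. -/
def SlowDecreaseAt (c : ℝ → ℝ) (K x : ℝ) : Prop :=
  ∀ᶠ z in 𝓝[>] x, c x * (1 - K * (z - x)) ≤ c z

lemma frequently_slope_lt_of_le {F G : ℝ → ℝ} {x G' r : ℝ} (hG : HasDerivAt G G' x)
    (hx : F x = G x) (hle : ∀ᶠ z in 𝓝[>] x, F z ≤ G z) (hr : G' < r) :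
    ∃ᶠ z in 𝓝[>] x, (z - x)⁻¹ * (F z - F x) < r := by
  have h1 := hasDerivWithinAt_iff_tendsto_slope.mp (hG.hasDerivWithinAt (s := Ioi x))
  have h2 : Ioi x \ {x} = Ioi x := by simp
  rw [h2] at h1
  refine Eventually.frequently ?_
  filter_upwards [h1.eventually (gt_mem_nhds hr), hle, self_mem_nhdsWithin] with z hz1 hz2 hz3
  refine lt_of_le_of_lt ?_ hz1
  rw [slope_def_field, div_eq_inv_mul, hx]
  exact mul_le_mul_of_nonneg_left (by linarith) (inv_nonneg.mpr (sub_nonneg.mpr (le_of_lt hz3)))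

/-- Under a one-sided logarithmic Lipschitz bound on `c`, the energy `v² + c λ² u²` cannot
decrease too fast.  No differentiability of `c` is needed. -/
lemma IsOscillator.energy_ge_of_slowDecrease {c u v : ℝ → ℝ} {lam K l r : ℝ}
    (h : IsOscillator (fun t => c t * lam ^ 2) u v) (hc : ContinuousOn c (Icc l r))
    (hK : 0 ≤ K) (hslow : ∀ x ∈ Ico l r, SlowDecreaseAt c K x)
    (hlr : l ≤ r) :
    (v l ^ 2 + c l * lam ^ 2 * u l ^ 2) * Real.exp (-K * (r - l)) ≤
      v r ^ 2 + c r * lam ^ 2 * u r ^ 2 := by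
  have hu := h.continuous_pos
  have hv := h.continuous_vel
  have key := le_gronwallBound_of_liminf_deriv_right_le (a := l) (b := r)
    (f := fun t => -(v t ^ 2 + c t * lam ^ 2 * u t ^ 2))
    (f' := fun t => K * (c t * lam ^ 2 * u t ^ 2))
    (δ := -(v l ^ 2 + c l * lam ^ 2 * u l ^ 2)) (K := -K) (ε := 0)
    (((hv.pow 2).continuousOn.add ((hc.mul continuousOn_const).mul (hu.pow 2).continuousOn)).neg)
    ?_ le_rfl ?_ r (right_mem_Icc.mpr hlr)
  · simp only [gronwallBound_ε0] at key
    linarith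
  · intro x hx s hs
    refine frequently_slope_lt_of_le
      (G := fun z => -(v z ^ 2 + c x * (1 - K * (z - x)) * lam ^ 2 * u z ^ 2))
      (G' := K * (c x * lam ^ 2 * u x ^ 2)) ?_ (by simp) ?_ hs
    · have h1 : HasDerivAt (fun z => c x * (1 - K * (z - x)) * lam ^ 2) (c x * -K * lam ^ 2) x := by
        have := (((((hasDerivAt_id x).sub_const x).const_mul K).const_sub 1).const_mul
          (c x)).mul_const (lam ^ 2)
        simpa using this
      refine (((h.deriv_vel x).pow 2).add (h1.mul ((h.deriv_pos x).pow 2))).neg.congr_deriv ?_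
      simp
      ring
    · filter_upwards [hslow x hx] with z hz
      have : 0 ≤ lam ^ 2 * u z ^ 2 := by positivity
      nlinarith
  · intro x hx
    have := sq_nonneg (v x)
    nlinarith

/-- The companion upper bound, for the energy `v² / c + λ² u²`. -/
lemma IsOscillator.energy_div_le_of_slowDecrease {c u v : ℝ → ℝ} {lam K l r : ℝ}
    (h : IsOscillator (fun t => c t * lam ^ 2) u v) (hc : ContinuousOn c (Icc l r))
    (hpos : ∀ t ∈ Icc l r, 0 < c t) (hK : 0 ≤ K) (hslow : ∀ x ∈ Ico l r, SlowDecreaseAt c K x)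
    (hlr : l ≤ r) :
    v r ^ 2 / c r + lam ^ 2 * u r ^ 2 ≤
      (v l ^ 2 / c l + lam ^ 2 * u l ^ 2) * Real.exp (K * (r - l)) := by
  have hu := h.continuous_pos
  have hv := h.continuous_vel
  have key := le_gronwallBound_of_liminf_deriv_right_le (a := l) (b := r)
    (f := fun t => v t ^ 2 / c t + lam ^ 2 * u t ^ 2)
    (f' := fun t => K * (v t ^ 2 / c t))
    (δ := v l ^ 2 / c l + lam ^ 2 * u l ^ 2) (K := K) (ε := 0)
    (((hv.pow 2).continuousOn.div hc fun t ht => (hpos t ht).ne').add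
      (continuousOn_const.mul (hu.pow 2).continuousOn))
    ?_ le_rfl ?_ r (right_mem_Icc.mpr hlr)
  · simpa only [gronwallBound_ε0] using key
  · intro x hx s hs
    have hcx : 0 < c x := hpos x ⟨hx.1, hx.2.le⟩
    refine frequently_slope_lt_of_le
      (G := fun z => v z ^ 2 / (c x * (1 - K * (z - x))) + lam ^ 2 * u z ^ 2)
      (G' := K * (v x ^ 2 / c x)) ?_ (by simp) ?_ hs
    · have h1 : HasDerivAt (fun z => c x * (1 - K * (z - x))) (c x * -K) x := by
        have := ((((hasDerivAt_id x).sub_const x).const_mul K).const_sub 1).const_mul (c x)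
        simpa using this
      refine ((((h.deriv_vel x).pow 2).div h1 (by simpa using hcx.ne')).add
        (((h.deriv_pos x).pow 2).const_mul (lam ^ 2))).congr_deriv ?_
      simp
      field_simp
      ring
    · have hev : ∀ᶠ z in 𝓝[>] x, K * (z - x) < 1 := by
        have : Tendsto (fun z => K * (z - x)) (𝓝[>] x) (𝓝 (K * (x - x))) :=
          (Continuous.tendsto (by fun_prop) x).mono_left nhdsWithin_le_nhds
        exact this.eventually (gt_mem_nhds (by simp))
      filter_upwards [hslow x hx, hev] with z hz hz1
      have h2 : 0 < c x * (1 - K * (z - x)) := mul_pos hcx (by linarith)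
      gcongr
  · intro x hx
    have : 0 ≤ lam ^ 2 * u x ^ 2 := by positivity
    nlinarith

end OneSided

/-! ### A resonant oscillator -/

section Resonance

/-- The exponent `(s - sin s cos s) / 8`, whose derivative is `sin² s / 4`. -/
noncomputable def growthExponent (s : ℝ) : ℝ := (s - Real.sin s * Real.cos s) / 8

/-- The perturbation for which `w = sin s · exp (growthExponent s)` solves `w'' + (1 + h) w = 0`. -/
noncomputable def resonantForcing (s : ℝ) : ℝ :=
  -(Real.sin s * Real.cos s) - Real.sin s ^ 4 / 16

lemma hasDerivAt_growthExponent (s : ℝ) : HasDerivAt growthExponent (Real.sin s ^ 2 / 4) s := by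
  refine (((hasDerivAt_id s).sub ((Real.hasDerivAt_sin s).mul
    (Real.hasDerivAt_cos s))).div_const 8).congr_deriv ?_
  have := Real.sin_sq_add_cos_sq s
  linear_combination (-1 / 8 : ℝ) * this

lemma monotone_growthExponent : Monotone growthExponent :=
  monotone_of_hasDerivAt_nonneg hasDerivAt_growthExponent fun s => by positivity

lemma growthExponent_nat_mul_pi (N : ℕ) : growthExponent (N * Real.pi) = N * Real.pi / 8 := by
  simp [growthExponent, Real.sin_nat_mul_pi]

lemma cos_nat_mul_pi_sub_pi_div_two (N : ℕ) : Real.cos (N * Real.pi - Real.pi / 2) = 0 := by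
  rw [Real.cos_sub_pi_div_two, Real.sin_nat_mul_pi]

lemma growthExponent_nat_mul_pi_sub (N : ℕ) :
    growthExponent (N * Real.pi - Real.pi / 2) = (N * Real.pi - Real.pi / 2) / 8 := by
  simp [growthExponent, cos_nat_mul_pi_sub_pi_div_two]

lemma abs_sin_mul_cos_le (s : ℝ) : |Real.sin s * Real.cos s| ≤ 1 / 2 := by
  rw [abs_le]
  constructor <;> nlinarith [Real.sin_sq_add_cos_sq s, sq_nonneg (Real.sin s + Real.cos s),
    sq_nonneg (Real.sin s - Real.cos s)]

lemma resonantForcing_mem (s : ℝ) : resonantForcing s ∈ Icc (-(9 / 16) : ℝ) (1 / 2) := by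
  have h1 := abs_le.mp (abs_sin_mul_cos_le s)
  have h2 : Real.sin s ^ 2 ≤ 1 := Real.sin_sq_le_one s
  have h3 : 0 ≤ Real.sin s ^ 2 := sq_nonneg _
  have h4 : Real.sin s ^ 4 = (Real.sin s ^ 2) ^ 2 := by ring
  rw [resonantForcing, h4]
  constructor <;> nlinarith

lemma resonantForcing_nat_mul_pi (N : ℕ) : resonantForcing (N * Real.pi) = 0 := by
  simp [resonantForcing, Real.sin_nat_mul_pi]

lemma resonantForcing_zero : resonantForcing 0 = 0 := by simp [resonantForcing]

lemma abs_resonantForcing_sub_le (s t : ℝ) :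
    |resonantForcing s - resonantForcing t| ≤ 2 * |s - t| := by
  have hd : ∀ x, HasDerivAt resonantForcing
      (-(Real.cos x * Real.cos x + Real.sin x * -Real.sin x) -
        4 * Real.sin x ^ 3 * Real.cos x / 16) x := by
    intro x
    refine ((((Real.hasDerivAt_sin x).mul (Real.hasDerivAt_cos x)).neg).sub
      (((Real.hasDerivAt_sin x).pow 4).div_const 16)).congr_deriv ?_
    simp
  have := Convex.norm_image_sub_le_of_norm_hasDerivWithin_le (f := resonantForcing) (C := 2)
    (fun x (_ : x ∈ (univ : Set ℝ)) => (hd x).hasDerivWithinAt) (fun x _ => ?_) convex_univ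
    (mem_univ t) (mem_univ s)
  · simpa using this
  · have h1 := Real.sin_sq_add_cos_sq x
    have h2 := abs_le.mp (abs_sin_mul_cos_le x)
    have h3 : Real.sin x ^ 2 ≤ 1 := Real.sin_sq_le_one x
    have h4 := sq_nonneg (Real.sin x)
    have h5 : 4 * Real.sin x ^ 3 * Real.cos x / 16 =
      Real.sin x ^ 2 * (Real.sin x * Real.cos x) / 4 := by ring
    have h6 : |Real.sin x ^ 2 * (Real.sin x * Real.cos x)| ≤ 1 := by
      rw [abs_mul, abs_of_nonneg h4]
      have := abs_sin_mul_cos_le x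
      have := abs_nonneg (Real.sin x * Real.cos x)
      nlinarith
    have h7 := abs_le.mp h6
    rw [h5, Real.norm_eq_abs, abs_le]
    constructor <;> nlinarith [sq_nonneg (Real.cos x)]

/-- The rescaled resonant solution, starting at time `t₀` with position `0` and velocity `b`. -/
lemma isOscillator_resonant {σ : ℝ} (hσ : σ ≠ 0) (b t₀ : ℝ) :
    IsOscillator (fun t => σ ^ 2 * (1 + resonantForcing (σ * (t - t₀))))
      (fun t => b / σ * (Real.sin (σ * (t - t₀)) * Real.exp (growthExponent (σ * (t - t₀)))))
      (fun t => b * ((Real.cos (σ * (t - t₀)) + Real.sin (σ * (t - t₀)) ^ 3 / 4) *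
        Real.exp (growthExponent (σ * (t - t₀))))) := by
  have hl : ∀ t, HasDerivAt (fun t => σ * (t - t₀)) σ t := fun t => by
    simpa using ((hasDerivAt_id t).sub_const t₀).const_mul σ
  have hE : ∀ t, HasDerivAt (fun t => Real.exp (growthExponent (σ * (t - t₀))))
      (Real.exp (growthExponent (σ * (t - t₀))) * (Real.sin (σ * (t - t₀)) ^ 2 / 4 * σ)) t :=
    fun t => ((hasDerivAt_growthExponent _).comp t (hl t)).exp
  have hS : ∀ t, HasDerivAt (fun t => Real.sin (σ * (t - t₀))) (Real.cos (σ * (t - t₀)) * σ) t :=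
    fun t => (hl t).sin
  have hC : ∀ t, HasDerivAt (fun t => Real.cos (σ * (t - t₀))) (-Real.sin (σ * (t - t₀)) * σ) t :=
    fun t => (hl t).cos
  constructor
  · intro t
    refine (((hS t).mul (hE t)).const_mul (b / σ)).congr_deriv ?_
    field_simp
  · intro t
    refine ((((hC t).add (((hS t).pow 3).div_const 4)).mul (hE t)).const_mul b).congr_deriv ?_
    simp only [resonantForcing]
    set S := Real.sin (σ * (t - t₀))
    set C := Real.cos (σ * (t - t₀))
    set X := Real.exp (growthExponent (σ * (t - t₀)))
    have h1 : S ^ 2 + C ^ 2 = 1 := Real.sin_sq_add_cos_sq _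
    simp
    field_simp
    ring

end Resonance

/-! ### The propagation speed -/

section Profile

/-- The piecewise linear ramp that is `0` on `(-∞, 1/2]` and `1` on `[1, ∞)`. -/
noncomputable def ramp (x : ℝ) : ℝ := max 0 (min 1 (2 * x - 1))

lemma ramp_mem (x : ℝ) : ramp x ∈ Icc (0 : ℝ) 1 :=
  ⟨le_max_left _ _, max_le zero_le_one (min_le_left _ _)⟩

lemma ramp_of_le {x : ℝ} (h : x ≤ 1 / 2) : ramp x = 0 :=
  max_eq_left ((min_le_right _ _).trans (by linarith))

lemma ramp_of_ge {x : ℝ} (h : 1 ≤ x) : ramp x = 1 := by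
  rw [ramp, min_eq_left (by linarith), max_eq_right zero_le_one]

lemma ramp_mono : Monotone ramp := fun x y h =>
  max_le_max le_rfl (min_le_min le_rfl (by linarith))

lemma abs_ramp_sub_le (x y : ℝ) : |ramp x - ramp y| ≤ 2 * |x - y| := by
  have h1 : |ramp x - ramp y| ≤ |min 1 (2 * x - 1) - min 1 (2 * y - 1)| := by
    simpa [ramp, max_comm] using abs_max_sub_max_le_abs (min 1 (2 * x - 1)) (min 1 (2 * y - 1)) 0
  have h2 : |min 1 (2 * x - 1) - min 1 (2 * y - 1)| ≤ |2 * x - 1 - (2 * y - 1)| := by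
    have := abs_min_sub_min_le_max 1 (2 * x - 1) 1 (2 * y - 1)
    simpa using this
  have h3 : |2 * x - 1 - (2 * y - 1)| = 2 * |x - y| := by
    rw [show 2 * x - 1 - (2 * y - 1) = 2 * (x - y) by ring, abs_mul, abs_two]
  linarith

/-- The number of half-turns (multiples of the angle `π`) of the resonant oscillation of angular frequency `σ` that starts at
time `t₀`: the least one for which it lasts at least `16 t₀`. -/
noncomputable def halfTurns (t₀ σ : ℝ) : ℕ := ⌈16 * (σ * t₀) / Real.pi⌉₊

/-- The time at which the resonant oscillation stops. -/
noncomputable def stopTime (t₀ σ : ℝ) : ℝ := t₀ + halfTurns t₀ σ * Real.pi / σ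

/-- The shape of the speed around the time `t₀`: a plateau of height `1` between `t₀` and `32 t₀`,
with linear ramps on `[t₀ / 2, t₀]` and `[32 t₀, 64 t₀]`, plus the resonant forcing between
`t₀` and `stopTime t₀ σ`. -/
noncomputable def profile (t₀ σ t : ℝ) : ℝ :=
  ramp (t / t₀) - ramp (t / (64 * t₀)) +
    resonantForcing (max 0 (min (halfTurns t₀ σ * Real.pi) (σ * (t - t₀))))

variable {t₀ σ : ℝ}

lemma pos_of_one_le_mul (ht₀ : 0 < t₀) (h : 1 ≤ σ * t₀) : 0 < σ :=
  pos_of_mul_pos_left (by linarith) ht₀.le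

lemma le_halfTurns_mul_pi (t₀ σ : ℝ) : 16 * (σ * t₀) ≤ halfTurns t₀ σ * Real.pi := by
  rw [← div_le_iff₀ Real.pi_pos]
  exact Nat.le_ceil _

lemma halfTurns_mul_pi_le (h : 1 ≤ σ * t₀) : halfTurns t₀ σ * Real.pi ≤ 20 * (σ * t₀) := by
  have h1 : (halfTurns t₀ σ : ℝ) < 16 * (σ * t₀) / Real.pi + 1 :=
    Nat.ceil_lt_add_one (by positivity)
  have h2 := mul_lt_mul_of_pos_right h1 Real.pi_pos
  rw [add_mul, div_mul_cancel₀ _ Real.pi_pos.ne'] at h2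
  linarith [Real.pi_lt_four]

lemma lt_stopTime (ht₀ : 0 < t₀) (h : 1 ≤ σ * t₀) : t₀ < stopTime t₀ σ := by
  have h1 := le_halfTurns_mul_pi t₀ σ
  have : 0 < halfTurns t₀ σ * Real.pi / σ := div_pos (by linarith) (pos_of_one_le_mul ht₀ h)
  rw [stopTime]
  linarith

lemma stopTime_le (ht₀ : 0 < t₀) (h : 1 ≤ σ * t₀) : stopTime t₀ σ ≤ 21 * t₀ := by
  have h1 := halfTurns_mul_pi_le h
  have h2 : halfTurns t₀ σ * Real.pi / σ ≤ 20 * t₀ := by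
    rw [div_le_iff₀ (pos_of_one_le_mul ht₀ h)]
    linarith
  rw [stopTime]
  linarith

lemma mul_sub_le_iff_le_stopTime (hσ : 0 < σ) {t : ℝ} :
    σ * (t - t₀) ≤ halfTurns t₀ σ * Real.pi ↔ t ≤ stopTime t₀ σ := by
  rw [stopTime, ← sub_le_iff_le_add', le_div_iff₀ hσ, mul_comm]

lemma profile_of_le (ht₀ : 0 < t₀) (h : 1 ≤ σ * t₀) {t : ℝ} (ht : t ≤ t₀) :
    profile t₀ σ t = ramp (t / t₀) := by
  have hσ := pos_of_one_le_mul ht₀ h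
  have h1 : σ * (t - t₀) ≤ 0 := mul_nonpos_of_nonneg_of_nonpos hσ.le (by linarith)
  have h2 : t / (64 * t₀) ≤ 1 / 2 := by rw [div_le_iff₀ (by positivity)]; linarith
  rw [profile, ramp_of_le h2, max_eq_left ((min_le_right _ _).trans h1), resonantForcing_zero]
  ring

lemma profile_of_le_half (ht₀ : 0 < t₀) (h : 1 ≤ σ * t₀) {t : ℝ} (ht : t ≤ t₀ / 2) :
    profile t₀ σ t = 0 := by
  rw [profile_of_le ht₀ h (by linarith), ramp_of_le]
  rw [div_le_iff₀ ht₀]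
  linarith

lemma profile_of_mem (ht₀ : 0 < t₀) (h : 1 ≤ σ * t₀) {t : ℝ}
    (ht : t ∈ Icc t₀ (stopTime t₀ σ)) :
    profile t₀ σ t = 1 + resonantForcing (σ * (t - t₀)) := by
  have hσ := pos_of_one_le_mul ht₀ h
  have h0 := stopTime_le ht₀ h
  have h1 : 0 ≤ σ * (t - t₀) := mul_nonneg hσ.le (by linarith [ht.1])
  have h2 : t / (64 * t₀) ≤ 1 / 2 := by rw [div_le_iff₀ (by positivity)]; linarith [ht.2]
  have h3 : 1 ≤ t / t₀ := by rw [le_div_iff₀ ht₀]; linarith [ht.1]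
  rw [profile, ramp_of_le h2, ramp_of_ge h3,
    min_eq_right ((mul_sub_le_iff_le_stopTime hσ).mpr ht.2), max_eq_right h1]
  ring

lemma profile_of_stopTime_le (ht₀ : 0 < t₀) (h : 1 ≤ σ * t₀) {t : ℝ} (ht : stopTime t₀ σ ≤ t) :
    profile t₀ σ t = 1 - ramp (t / (64 * t₀)) := by
  have hσ := pos_of_one_le_mul ht₀ h
  have h0 := lt_stopTime ht₀ h
  have h1 : halfTurns t₀ σ * Real.pi ≤ σ * (t - t₀) := by
    rcases ht.eq_or_lt with rfl | hlt
    · rw [stopTime, add_sub_cancel_left, mul_div_cancel₀ _ hσ.ne']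
    · exact (not_le.mp fun hc => absurd ((mul_sub_le_iff_le_stopTime hσ).mp hc)
        (not_le.mpr hlt)).le
  have h3 : 1 ≤ t / t₀ := by rw [le_div_iff₀ ht₀]; linarith
  rw [profile, ramp_of_ge h3, min_eq_left h1, max_eq_right (by positivity),
    resonantForcing_nat_mul_pi]
  ring

lemma profile_of_mem_plateau (ht₀ : 0 < t₀) (h : 1 ≤ σ * t₀) {t : ℝ}
    (ht : t ∈ Icc (stopTime t₀ σ) (32 * t₀)) : profile t₀ σ t = 1 := by
  rw [profile_of_stopTime_le ht₀ h ht.1, ramp_of_le, sub_zero]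
  rw [div_le_iff₀ (by positivity)]
  linarith [ht.2]

lemma profile_of_ge (ht₀ : 0 < t₀) (h : 1 ≤ σ * t₀) {t : ℝ} (ht : 64 * t₀ ≤ t) :
    profile t₀ σ t = 0 := by
  rw [profile_of_stopTime_le ht₀ h ((stopTime_le ht₀ h).trans (by linarith)), ramp_of_ge, sub_self]
  rw [le_div_iff₀ (by positivity)]
  linarith

lemma le_profile (ht₀ : 0 < t₀) (h : 1 ≤ σ * t₀) {t : ℝ} (ht : t ∈ Icc t₀ (32 * t₀)) :
    7 / 16 ≤ profile t₀ σ t := by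
  rcases le_total t (stopTime t₀ σ) with h1 | h1
  · rw [profile_of_mem ht₀ h ⟨ht.1, h1⟩]
    linarith [(resonantForcing_mem (σ * (t - t₀))).1]
  · rw [profile_of_mem_plateau ht₀ h ⟨h1, ht.2⟩]
    norm_num

lemma profile_mem (ht₀ : 0 < t₀) (h : 1 ≤ σ * t₀) (t : ℝ) :
    profile t₀ σ t ∈ Icc (0 : ℝ) (3 / 2) := by
  rcases le_total t t₀ with h1 | h1
  · rw [profile_of_le ht₀ h h1]
    have := ramp_mem (t / t₀)
    exact ⟨this.1, by linarith [this.2]⟩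
  rcases le_total t (stopTime t₀ σ) with h2 | h2
  · rw [profile_of_mem ht₀ h ⟨h1, h2⟩]
    have := resonantForcing_mem (σ * (t - t₀))
    exact ⟨by linarith [this.1], by linarith [this.2]⟩
  · rw [profile_of_stopTime_le ht₀ h h2]
    have := ramp_mem (t / (64 * t₀))
    exact ⟨by linarith [this.2], by linarith [this.1]⟩

lemma abs_profile_sub_le (ht₀ : 0 < t₀) (h : 1 ≤ σ * t₀) (a b : ℝ) :
    |profile t₀ σ a - profile t₀ σ b| ≤ 5 * (σ * |a - b|) := by
  have hσ := pos_of_one_le_mul ht₀ h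
  set M : ℝ := halfTurns t₀ σ * Real.pi
  have h0 : |a - b| / t₀ ≤ σ * |a - b| := by
    rw [div_le_iff₀ ht₀]
    nlinarith [abs_nonneg (a - b)]
  have h1 : |ramp (a / t₀) - ramp (b / t₀)| ≤ 2 * (σ * |a - b|) := by
    refine (abs_ramp_sub_le _ _).trans ?_
    rw [← sub_div, abs_div, abs_of_pos ht₀]
    linarith
  have h2 : |ramp (a / (64 * t₀)) - ramp (b / (64 * t₀))| ≤ σ * |a - b| := by
    refine (abs_ramp_sub_le _ _).trans ?_
    rw [← sub_div, abs_div, abs_of_pos (by positivity : 0 < 64 * t₀), mul_comm 64 t₀, ← div_div]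
    have : 0 ≤ |a - b| / t₀ := by positivity
    linarith
  have h3 : |resonantForcing (max 0 (min M (σ * (a - t₀)))) -
      resonantForcing (max 0 (min M (σ * (b - t₀))))| ≤ 2 * (σ * |a - b|) := by
    refine (abs_resonantForcing_sub_le _ _).trans ?_
    have e1 : |max 0 (min M (σ * (a - t₀))) - max 0 (min M (σ * (b - t₀)))| ≤
        |min M (σ * (a - t₀)) - min M (σ * (b - t₀))| := by
      simpa [max_comm] using
        abs_max_sub_max_le_abs (min M (σ * (a - t₀))) (min M (σ * (b - t₀))) 0
    have e2 : |min M (σ * (a - t₀)) - min M (σ * (b - t₀))| ≤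
        |σ * (a - t₀) - σ * (b - t₀)| := by
      simpa using abs_min_sub_min_le_max M (σ * (a - t₀)) M (σ * (b - t₀))
    have e3 : |σ * (a - t₀) - σ * (b - t₀)| = σ * |a - b| := by
      rw [show σ * (a - t₀) - σ * (b - t₀) = σ * (a - b) by ring, abs_mul, abs_of_pos hσ]
    linarith
  have e : profile t₀ σ a - profile t₀ σ b = (ramp (a / t₀) - ramp (b / t₀)) -
      (ramp (a / (64 * t₀)) - ramp (b / (64 * t₀))) +
      (resonantForcing (max 0 (min M (σ * (a - t₀)))) -
      resonantForcing (max 0 (min M (σ * (b - t₀))))) := by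
    simp only [profile]; ring
  rw [e]
  refine (abs_add_le _ _).trans ?_
  have := abs_sub (ramp (a / t₀) - ramp (b / t₀))
    (ramp (a / (64 * t₀)) - ramp (b / (64 * t₀)))
  linarith

end Profile

section Speed

/-- The `k`-th reference time `τ / 64 ^ k`. -/
noncomputable def node (τ : ℝ) (k : ℕ) : ℝ := τ / 64 ^ k

/-- The propagation speed: around the time `node τ k` it is of size `δ k` and oscillates with
angular frequency `σ k`. -/
noncomputable def speed (τ : ℝ) (σ δ : ℕ → ℝ) (t : ℝ) : ℝ :=
  ∑' k, δ k * profile (node τ k) (σ k) t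

/-- The standing assumptions on the parameters of `speed`. -/
structure IsStaging (τ : ℝ) (σ δ : ℕ → ℝ) : Prop where
  pos : 0 < τ
  amp_pos : ∀ k, 0 < δ k
  amp_zero : δ 0 ≤ 1 / 2
  amp_succ : ∀ k, δ (k + 1) ≤ δ k / 4
  freq_mono : Monotone σ
  one_le : ∀ k, 1 ≤ σ k * node τ k

variable {τ : ℝ} {σ δ : ℕ → ℝ}

lemma node_succ (τ : ℝ) (k : ℕ) : 64 * node τ (k + 1) = node τ k := by
  rw [node, node, pow_succ]; field_simp

lemma node_zero (τ : ℝ) : node τ 0 = τ := by simp [node]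

lemma tendsto_node (τ : ℝ) : Tendsto (node τ) atTop (𝓝 0) := by
  have := (tendsto_pow_atTop_nhds_zero_of_lt_one (r := (1 / 64 : ℝ)) (by norm_num)
    (by norm_num)).const_mul τ
  rw [mul_zero] at this
  refine this.congr fun k => ?_
  rw [node, one_div, inv_pow, div_eq_mul_inv]

/-- The positive times split into plateaus and ramps. -/
lemma exists_node_mem {τ t : ℝ} (ht0 : 0 < t) (ht : t < 32 * τ) :
    ∃ k, t ∈ Ico (node τ k) (32 * node τ k) ∨ t ∈ Ico (32 * node τ (k + 1)) (node τ k) := by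
  classical
  have hex : ∃ k, node τ k ≤ t :=
    (((tendsto_node τ).eventually (gt_mem_nhds ht0)).exists).imp fun k hk => le_of_lt hk
  obtain ⟨k, hk⟩ : ∃ k, k = Nat.find hex := ⟨_, rfl⟩
  have hk1 : node τ k ≤ t := hk ▸ Nat.find_spec hex
  rcases k with _ | j
  · exact ⟨0, Or.inl ⟨hk1, by rwa [node_zero]⟩⟩
  · have hlt : t < node τ j := not_le.mp (Nat.find_min hex (by omega))
    rcases lt_or_ge t (32 * node τ (j + 1)) with h1 | h1
    · exact ⟨j + 1, Or.inl ⟨hk1, h1⟩⟩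
    · exact ⟨j, Or.inr ⟨h1, hlt⟩⟩

namespace IsStaging

variable (h : IsStaging τ σ δ)
include h

lemma node_pos (k : ℕ) : 0 < node τ k := div_pos h.pos (by positivity)

lemma node_anti : Antitone (node τ) :=
  antitone_nat_of_succ_le fun k => by linarith [node_succ τ k, h.node_pos (k + 1)]

lemma node_lt {j k : ℕ} (hjk : j < k) : 64 * node τ k ≤ node τ j := by
  obtain ⟨i, rfl⟩ : ∃ i, k = i + 1 := ⟨k - 1, by omega⟩
  rw [node_succ]
  exact h.node_anti (by omega)

lemma freq_pos (k : ℕ) : 0 < σ k := pos_of_one_le_mul (h.node_pos k) (h.one_le k)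

lemma amp_add_le (k i : ℕ) : δ (i + k) ≤ δ k * (1 / 4) ^ i := by
  induction i with
  | zero => simp
  | succ i ih =>
    have := h.amp_succ (i + k)
    rw [show i + 1 + k = i + k + 1 by ring, pow_succ]
    linarith

lemma amp_anti : Antitone δ :=
  antitone_nat_of_succ_le fun k => by linarith [h.amp_succ k, h.amp_pos k]

lemma amp_le (k : ℕ) : δ k ≤ 1 / 2 := (h.amp_anti (Nat.zero_le k)).trans h.amp_zero

lemma term_nonneg (k : ℕ) (t : ℝ) : 0 ≤ δ k * profile (node τ k) (σ k) t :=
  mul_nonneg (h.amp_pos k).le (profile_mem (h.node_pos k) (h.one_le k) t).1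

lemma term_le (k : ℕ) (t : ℝ) :
    δ k * profile (node τ k) (σ k) t ≤ 3 / 4 * (1 / 4) ^ k := by
  have h1 := (profile_mem (h.node_pos k) (h.one_le k) t)
  have h2 := h.amp_add_le 0 k
  have h3 : (0 : ℝ) < (1 / 4) ^ k := by positivity
  have h4 : δ k ≤ 1 / 2 * (1 / 4) ^ k := by
    have := mul_le_mul_of_nonneg_right h.amp_zero h3.le
    simp only [add_zero] at h2
    linarith
  nlinarith [h1.1, h1.2, h.amp_pos k]

lemma summable_term (t : ℝ) : Summable fun k => δ k * profile (node τ k) (σ k) t :=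
  Summable.of_nonneg_of_le (fun k => h.term_nonneg k t) (fun k => h.term_le k t)
    ((summable_geometric_of_lt_one (by norm_num) (by norm_num)).mul_left _)

lemma speed_nonneg (t : ℝ) : 0 ≤ speed τ σ δ t := tsum_nonneg fun k => h.term_nonneg k t

lemma speed_le (t : ℝ) : speed τ σ δ t ≤ 3 / 2 := by
  have h1 := (h.summable_term t).tsum_le_tsum (fun k => h.term_le k t)
    ((summable_geometric_of_lt_one (by norm_num) (by norm_num)).mul_left _)
  rw [tsum_mul_left, tsum_geometric_of_lt_one (by norm_num) (by norm_num)] at h1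
  exact h1.trans (by norm_num)

lemma continuous_profile (k : ℕ) : Continuous (profile (node τ k) (σ k)) := by
  have : LipschitzWith (5 * σ k).toNNReal (profile (node τ k) (σ k)) :=
    LipschitzWith.of_dist_le_mul fun a b => by
      rw [Real.coe_toNNReal _ (by linarith [h.freq_pos k]), Real.dist_eq, Real.dist_eq]
      linarith [abs_profile_sub_le (h.node_pos k) (h.one_le k) a b]
  exact this.continuous

lemma continuous_speed : Continuous (speed τ σ δ) := by
  refine continuous_tsum (fun k => continuous_const.mul (h.continuous_profile k))
    ((summable_geometric_of_lt_one (r := (1 / 4 : ℝ)) (by norm_num) (by norm_num)).mul_left (3 / 4))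
    fun k t => ?_
  rw [Real.norm_eq_abs, abs_of_nonneg (h.term_nonneg k t)]
  exact h.term_le k t

lemma profile_eq_zero_of_lt {j k : ℕ} (hjk : j < k) {t : ℝ} (ht : t ≤ 32 * node τ k) :
    profile (node τ j) (σ j) t = 0 :=
  profile_of_le_half (h.node_pos j) (h.one_le j) (by linarith [h.node_lt hjk])

lemma profile_eq_zero_of_gt {j k : ℕ} (hjk : k < j) {t : ℝ} (ht : node τ k ≤ t) :
    profile (node τ j) (σ j) t = 0 :=
  profile_of_ge (h.node_pos j) (h.one_le j) (by linarith [h.node_lt hjk])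

lemma speed_eq {k : ℕ} {t : ℝ} (ht : t ∈ Icc (node τ k) (32 * node τ k)) :
    speed τ σ δ t = δ k * profile (node τ k) (σ k) t := by
  refine tsum_eq_single k fun j hj => ?_
  rcases lt_or_gt_of_ne hj with hlt | hgt
  · rw [h.profile_eq_zero_of_lt hlt ht.2, mul_zero]
  · rw [h.profile_eq_zero_of_gt hgt ht.1, mul_zero]

lemma speed_eq_ramp {k : ℕ} {t : ℝ} (ht : t ∈ Icc (32 * node τ (k + 1)) (node τ k)) :
    speed τ σ δ t = δ (k + 1) + (δ k - δ (k + 1)) * ramp (t / node τ k) := by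
  have h1 : speed τ σ δ t = ∑ j ∈ {k, k + 1}, δ j * profile (node τ j) (σ j) t := by
    refine tsum_eq_sum fun j hj => ?_
    have hk := h.node_pos (k + 1)
    have hk2 := node_succ τ k
    simp only [Finset.mem_insert, Finset.mem_singleton, not_or] at hj
    rcases lt_or_gt_of_ne hj.1 with hlt | hgt
    · rw [h.profile_eq_zero_of_lt hlt (by linarith [ht.2]), mul_zero]
    · rw [h.profile_eq_zero_of_gt (k := k + 1) (by omega) (by linarith [ht.1]), mul_zero]
  rw [h1, Finset.sum_pair (by omega), profile_of_le (h.node_pos k) (h.one_le k) ht.2,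
    profile_of_stopTime_le (h.node_pos _) (h.one_le _)
      ((stopTime_le (h.node_pos _) (h.one_le _)).trans
        (by linarith [ht.1, h.node_pos (k + 1)])), node_succ]
  ring

lemma speed_le_of_le_node {k : ℕ} {t : ℝ} (ht : t ≤ node τ k) :
    speed τ σ δ t ≤ 3 / 2 * δ k := by
  have hs := h.summable_term t
  have h0 : ∑ i ∈ Finset.range k, δ i * profile (node τ i) (σ i) t = 0 :=
    Finset.sum_eq_zero fun i hi => by
      rw [h.profile_eq_zero_of_lt (Finset.mem_range.mp hi) (by linarith [h.node_pos k]), mul_zero]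
  have h1 : speed τ σ δ t = ∑' i, δ (i + k) * profile (node τ (i + k)) (σ (i + k)) t := by
    rw [speed, ← hs.sum_add_tsum_nat_add k, h0, zero_add]
  have hs1 := (summable_nat_add_iff k).mpr hs
  rw [h1, hs1.tsum_eq_zero_add, zero_add, profile_of_le (h.node_pos k) (h.one_le k) ht]
  have h2 : ∀ i, δ (i + 1 + k) * profile (node τ (i + 1 + k)) (σ (i + 1 + k)) t ≤
      3 / 8 * δ k * (1 / 4) ^ i := by
    intro i
    have e1 := h.amp_add_le k (i + 1)
    have e2 := profile_mem (h.node_pos (i + 1 + k)) (h.one_le (i + 1 + k)) t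
    have e3 := h.amp_pos (i + 1 + k)
    rw [pow_succ] at e1
    nlinarith [e2.1, e2.2]
  have h3 := ((summable_nat_add_iff 1).mpr hs1).tsum_le_tsum h2
    ((summable_geometric_of_lt_one (by norm_num) (by norm_num)).mul_left _)
  rw [tsum_mul_left, tsum_geometric_of_lt_one (by norm_num) (by norm_num)] at h3
  have h4 := (ramp_mem (t / node τ k)).2
  have h5 := h.amp_pos k
  have h6 : δ k * ramp (t / node τ k) ≤ δ k := mul_le_of_le_one_right h5.le h4
  norm_num at h3
  linarith

lemma speed_pos {t : ℝ} (ht0 : 0 < t) (ht : t ≤ 32 * τ) : 0 < speed τ σ δ t := by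
  have key : ∀ k, t ∈ Icc (node τ k) (32 * node τ k) → 0 < speed τ σ δ t := by
    intro k hk
    rw [h.speed_eq hk]
    exact mul_pos (h.amp_pos k) (by linarith [le_profile (h.node_pos k) (h.one_le k) hk])
  rcases ht.eq_or_lt with heq | hlt
  · have := h.pos
    refine key 0 ?_
    rw [node_zero]
    exact ⟨by linarith, ht⟩
  obtain ⟨k, hk | hk⟩ := exists_node_mem ht0 hlt
  · exact key k ⟨hk.1, hk.2.le⟩
  · rw [h.speed_eq_ramp ⟨hk.1, hk.2.le⟩]
    have h1 := h.amp_pos (k + 1)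
    have h2 := h.amp_succ k
    have h3 := (ramp_mem (t / node τ k)).1
    have : 0 ≤ (δ k - δ (k + 1)) * ramp (t / node τ k) := mul_nonneg (by linarith) h3
    linarith

/-- After the `k`-th oscillation has stopped, the speed decreases only during the oscillations of
lower index: its rate of decrease does not depend on `σ k` or on any later frequency. -/
lemma slowDecreaseAt {k : ℕ} {K : ℝ} (hK : 0 ≤ K) (hKσ : ∀ j < k, 20 * σ j ≤ K) {x : ℝ}
    (hx : stopTime (node τ k) (σ k) ≤ x) (hx2 : x < 32 * τ) :
    SlowDecreaseAt (speed τ σ δ) K x := by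
  have hkx : node τ k < x := (lt_stopTime (h.node_pos k) (h.one_le k)).trans_le hx
  have hx0 : 0 < x := (h.node_pos k).trans hkx
  have hcx := h.speed_nonneg x
  have mono : ∀ y, (∀ᶠ z in 𝓝[>] x, z < y → speed τ σ δ x ≤ speed τ σ δ z) → x < y →
      SlowDecreaseAt (speed τ σ δ) K x := by
    intro y hy hxy
    filter_upwards [hy, Ioo_mem_nhdsGT hxy] with z hz hz2
    have h1 : 0 ≤ K * (z - x) := mul_nonneg hK (by linarith [hz2.1])
    have h2 := hz hz2.2
    nlinarith
  obtain ⟨i, hi | hi⟩ := exists_node_mem hx0 hx2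
  · have hik : i ≤ k := by
      by_contra hc
      have := h.node_lt (not_le.mp hc)
      have := h.node_pos i
      linarith [hi.2]
    rcases hik.eq_or_lt with rfl | hik
    · -- the `k`-th oscillation is over, and the speed is constant up to `32 * node τ k`
      refine mono (32 * node τ i) ?_ hi.2
      filter_upwards [self_mem_nhdsWithin] with z (hz : x < z) hz2
      rw [h.speed_eq ⟨hi.1, hi.2.le⟩, h.speed_eq ⟨by linarith [hi.1], hz2.le⟩,
        profile_of_mem_plateau (h.node_pos i) (h.one_le i) ⟨hx, hi.2.le⟩,
        profile_of_mem_plateau (h.node_pos i) (h.one_le i) ⟨by linarith, hz2.le⟩]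
    · filter_upwards [Ioo_mem_nhdsGT hi.2] with z hz
      have h1 := (abs_le.mp (abs_profile_sub_le (h.node_pos i) (h.one_le i) z x)).1
      rw [abs_of_pos (by linarith [hz.1] : 0 < z - x)] at h1
      have h2 := le_profile (h.node_pos i) (h.one_le i) ⟨hi.1, hi.2.le⟩
      rw [h.speed_eq ⟨hi.1, hi.2.le⟩, h.speed_eq ⟨by linarith [hi.1, hz.1], hz.2.le⟩, mul_assoc]
      refine mul_le_mul_of_nonneg_left ?_ (h.amp_pos i).le
      -- the profile is `5 σ i`-Lipschitz and at least `7 / 16`, whence the constant `20`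
      have h3 : 20 * σ i * (z - x) ≤ K * (z - x) :=
        mul_le_mul_of_nonneg_right (hKσ i hik) (by linarith [hz.1])
      have h4 : 0 ≤ σ i * (z - x) := mul_nonneg (h.freq_pos i).le (by linarith [hz.1])
      nlinarith
  · refine mono (node τ i) ?_ hi.2
    filter_upwards [self_mem_nhdsWithin] with z (hz : x < z) hz2
    rw [h.speed_eq_ramp ⟨hi.1, hi.2.le⟩, h.speed_eq_ramp ⟨by linarith [hi.1], hz2.le⟩]
    have h1 : ramp (x / node τ i) ≤ ramp (z / node τ i) :=
      ramp_mono (div_le_div_of_nonneg_right hz.le (h.node_pos i).le)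
    have h2 := h.amp_succ i
    have h3 := h.amp_pos i
    have := mul_le_mul_of_nonneg_left h1 (by linarith : 0 ≤ δ i - δ (i + 1))
    linarith

end IsStaging

lemma IsModulus.nonneg {ω : ℝ → ℝ} (hω : IsModulus ω) {x : ℝ} (hx : 0 ≤ x) : 0 ≤ ω x := by
  rcases hx.eq_or_lt with rfl | h
  · rw [hω.map_zero]
  · exact (hω.pos x h).le

lemma IsModulus.mul_le {ω : ℝ → ℝ} (hω : IsModulus ω) {x y : ℝ} (hx : 0 < x) (hxy : x ≤ y) :
    x * ω y ≤ y * ω x := by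
  have h1 := hω.div_monotoneOn (mem_Ioi.mpr hx) (mem_Ioi.mpr (hx.trans_le hxy)) hxy
  simp only at h1
  rwa [div_le_div_iff₀ (hω.pos x hx) (hω.pos y (hx.trans_le hxy))] at h1

/-- A function bounded by `1` and `s`-Lipschitz is `ω`-continuous with constant `1 / ω (1 / s)`. -/
lemma IsModulus.min_one_mul_le {ω : ℝ → ℝ} (hω : IsModulus ω) {s x : ℝ} (hs : 0 < s)
    (hx : 0 ≤ x) : ω (1 / s) * min 1 (s * x) ≤ ω x := by
  have hs' : 0 < 1 / s := by positivity
  have hωs := hω.pos _ hs'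
  rcases le_total (1 / s) x with h | h
  · have h1 := hω.monotoneOn hs'.le hx h
    have h2 : ω (1 / s) * min 1 (s * x) ≤ ω (1 / s) * 1 :=
      mul_le_mul_of_nonneg_left (min_le_left _ _) hωs.le
    linarith
  · rcases hx.eq_or_lt with rfl | hx0
    · simp [hω.map_zero]
    · have h1 := hω.mul_le hx0 h
      have h2 : ω (1 / s) * min 1 (s * x) ≤ ω (1 / s) * (s * x) :=
        mul_le_mul_of_nonneg_left (min_le_right _ _) hωs.le
      have h3 : s * (x * ω (1 / s)) ≤ s * (1 / s * ω x) := mul_le_mul_of_nonneg_left h1 hs.le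
      have h4 : s * (1 / s * ω x) = ω x := by field_simp
      linarith

lemma IsStaging.abs_speed_sub_le (h : IsStaging τ σ δ) {ω : ℝ → ℝ} (hω : IsModulus ω)
    (hδ : ∀ k, δ k ≤ (1 / 2) ^ k * ω (1 / σ k)) (a b : ℝ) :
    |speed τ σ δ a - speed τ σ δ b| ≤ 10 * ω |a - b| := by
  have hterm : ∀ k, |δ k * profile (node τ k) (σ k) a - δ k * profile (node τ k) (σ k) b| ≤
      5 * ω |a - b| * (1 / 2) ^ k := by
    intro k
    have hσ := h.freq_pos k
    have h1 := abs_profile_sub_le (h.node_pos k) (h.one_le k) a b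
    have h2 : |profile (node τ k) (σ k) a - profile (node τ k) (σ k) b| ≤ 5 := by
      have ha := profile_mem (h.node_pos k) (h.one_le k) a
      have hb := profile_mem (h.node_pos k) (h.one_le k) b
      rw [abs_le]
      constructor <;> linarith [ha.1, ha.2, hb.1, hb.2]
    have h3 : |profile (node τ k) (σ k) a - profile (node τ k) (σ k) b| ≤
        5 * min 1 (σ k * |a - b|) := by
      rw [mul_min_of_nonneg _ _ (by norm_num)]
      exact le_min (by linarith) h1
    have h4 := hω.min_one_mul_le hσ (abs_nonneg (a - b))
    have h5 : 0 ≤ min 1 (σ k * |a - b|) := le_min zero_le_one (by positivity)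
    rw [← mul_sub, abs_mul, abs_of_pos (h.amp_pos k)]
    calc _ ≤ (1 / 2) ^ k * ω (1 / σ k) * (5 * min 1 (σ k * |a - b|)) :=
          mul_le_mul (hδ k) h3 (abs_nonneg _)
            ((h.amp_pos k).le.trans (hδ k))
      _ = 5 * (1 / 2) ^ k * (ω (1 / σ k) * min 1 (σ k * |a - b|)) := by ring
      _ ≤ 5 * (1 / 2) ^ k * ω |a - b| := mul_le_mul_of_nonneg_left h4 (by positivity)
      _ = _ := by ring
  have hs : HasSum (fun k : ℕ => 5 * ω |a - b| * (1 / 2 : ℝ) ^ k) (5 * ω |a - b| * 2) :=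
    hasSum_geometric_two.mul_left _
  have := tsum_of_norm_bounded hs (fun k => (Real.norm_eq_abs _).trans_le (hterm k))
  rw [(h.summable_term a).tsum_sub (h.summable_term b), Real.norm_eq_abs] at this
  rw [speed, speed]
  linarith

end Speed

/-! ### The high-frequency modes -/

section Modes

variable {τ : ℝ} {σ δ : ℕ → ℝ}

/-- Once the `k`-th oscillation has stopped, the energy of a mode is controlled from both sides by
its value at the stopping time. -/
lemma IsStaging.late_energy (h : IsStaging τ σ δ) (hτ : 32 * τ ≤ 1) {k : ℕ} {lam K : ℝ}
    {U V : ℝ → ℝ} (hosc : IsOscillator (fun t => speed τ σ δ t * lam ^ 2) U V)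
    (hK : 0 ≤ K) (hKσ : ∀ j < k, 20 * σ j ≤ K)
    (hU : U (stopTime (node τ k) (σ k)) = 0) {t : ℝ}
    (ht : t ∈ Icc (stopTime (node τ k) (σ k)) (32 * τ)) :
    lam ^ 2 * U t ^ 2 + V t ^ 2 ≤
        3 / 2 * (V (stopTime (node τ k) (σ k)) ^ 2 / δ k * Real.exp K) ∧
      2 / 3 * (V (stopTime (node τ k) (σ k)) ^ 2 * Real.exp (-K)) ≤
        lam ^ 2 * U t ^ 2 + V t ^ 2 := by
  have ht₀ := h.node_pos k
  have ht01 := lt_stopTime ht₀ (h.one_le k)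
  have ht1 := stopTime_le ht₀ (h.one_le k)
  have hd := h.amp_pos k
  set t₁ := stopTime (node τ k) (σ k)
  have hc1 : speed τ σ δ t₁ = δ k := by
    rw [h.speed_eq ⟨ht01.le, by linarith⟩,
      profile_of_mem_plateau ht₀ (h.one_le k) ⟨le_rfl, by linarith⟩, mul_one]
  have hcpos : ∀ x ∈ Icc t₁ t, 0 < speed τ σ δ x := fun x hx =>
    h.speed_pos (by linarith [hx.1]) (hx.2.trans ht.2)
  have hslow : ∀ x ∈ Ico t₁ t, SlowDecreaseAt (speed τ σ δ) K x := fun x hx =>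
    h.slowDecreaseAt hK hKσ hx.1 (hx.2.trans_le ht.2)
  have hKt : K * (t - t₁) ≤ K := mul_le_of_le_one_right hK (by linarith [ht.2])
  have hc0 := hcpos t (right_mem_Icc.mpr ht.1)
  have hc := h.speed_le t
  have hU0 : 0 ≤ lam ^ 2 * U t ^ 2 := by positivity
  constructor
  · have e1 := hosc.energy_div_le_of_slowDecrease h.continuous_speed.continuousOn hcpos hK hslow
      ht.1
    rw [hU, hc1, zero_pow two_ne_zero, mul_zero, add_zero] at e1
    have e2 := e1.trans (mul_le_mul_of_nonneg_left (Real.exp_le_exp.mpr hKt) (by positivity))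
    have e3 : V t ^ 2 ≤ 3 / 2 * (V t ^ 2 / speed τ σ δ t) := by
      rw [← mul_div_assoc, le_div_iff₀ hc0]
      nlinarith [sq_nonneg (V t)]
    linarith
  · have e1 := hosc.energy_ge_of_slowDecrease h.continuous_speed.continuousOn hK hslow ht.1
    rw [hU, hc1, zero_pow two_ne_zero, mul_zero, add_zero] at e1
    have e2 : Real.exp (-K) ≤ Real.exp (-K * (t - t₁)) := Real.exp_le_exp.mpr (by linarith)
    have e3 := (mul_le_mul_of_nonneg_left e2 (sq_nonneg (V t₁))).trans e1
    have e4 := mul_le_mul_of_nonneg_right hc hU0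
    nlinarith [sq_nonneg (V t)]

/-- The mode in resonance with the `k`-th oscillation of the speed.  It carries almost no energy at
time `0`, is amplified between `node τ k` and the stopping time, and afterwards keeps its energy up
to a factor that only depends on the oscillations of lower index. -/
lemma IsStaging.exists_mode (h : IsStaging τ σ δ) (hτ : 32 * τ ≤ 1) {k : ℕ} {lam ρ K : ℝ}
    (hlam : 0 < lam) (hρ : 0 < ρ) (hrel : lam ^ 2 * δ k = σ k ^ 2) (hK : 0 ≤ K)
    (hKσ : ∀ j < k, 20 * σ j ≤ K) :
    ∃ U V : ℝ → ℝ, IsOscillator (fun t => speed τ σ δ t * lam ^ 2) U V ∧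
      (∀ t ∈ Icc 0 (32 * τ), lam * (lam ^ 2 * U t ^ 2 + V t ^ 2) ≤ 3 * ρ * Real.exp K) ∧
      lam * (lam ^ 2 * U 0 ^ 2 + V 0 ^ 2) ≤ ρ * Real.exp (-3 * (σ k * node τ k)) ∧
      (∀ t ∈ Icc (stopTime (node τ k) (σ k)) (32 * τ),
        2 / 3 * (δ k * ρ / lam * Real.exp (-K)) ≤ lam ^ 2 * U t ^ 2 + V t ^ 2) ∧
      ∃ t ∈ Ioc (node τ k) (stopTime (node τ k) (σ k)), ρ / 2 ≤ lam * (lam ^ 2 * U t ^ 2) := by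
  set t₀ := node τ k with ht₀
  set s := σ k
  set d := δ k
  have ht₀pos : 0 < t₀ := h.node_pos k
  have hone : 1 ≤ s * t₀ := h.one_le k
  have hs : 0 < s := h.freq_pos k
  have hd : 0 < d := h.amp_pos k
  have hd1 : d ≤ 1 / 2 := h.amp_le k
  set N := halfTurns t₀ s
  set t₁ := stopTime t₀ s with ht₁
  have hN : 16 * (s * t₀) ≤ N * Real.pi := le_halfTurns_mul_pi t₀ s
  have ht01 : t₀ < t₁ := lt_stopTime ht₀pos hone
  have ht1 : t₁ ≤ 21 * t₀ := stopTime_le ht₀pos hone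
  have ht0τ : t₀ ≤ τ := by
    have := h.node_anti (Nat.zero_le k)
    rwa [node_zero] at this
  set G : ℝ := N * Real.pi / 8 with hG
  obtain ⟨b, hb⟩ : ∃ b : ℝ, b ^ 2 = d * ρ / lam * Real.exp (-G) ^ 2 :=
    ⟨√(d * ρ / lam) * Real.exp (-G), by rw [mul_pow, Real.sq_sqrt (by positivity)]⟩
  have hbsq : b ^ 2 * Real.exp G ^ 2 = d * ρ / lam := by
    rw [hb, mul_assoc, ← mul_pow, ← Real.exp_add]
    simp
  have hcont : Continuous fun t => speed τ σ δ t * lam ^ 2 :=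
    h.continuous_speed.mul continuous_const
  have hbnd : ∀ t, |speed τ σ δ t * lam ^ 2| ≤ 3 / 2 * lam ^ 2 := fun t => by
    rw [abs_of_nonneg (mul_nonneg (h.speed_nonneg t) (sq_nonneg _))]
    exact mul_le_mul_of_nonneg_right (h.speed_le t) (sq_nonneg _)
  obtain ⟨U, V, hosc, hU0, hV0⟩ := exists_isOscillator hcont hbnd t₀ 0 b
  have hexp := hosc.eqOn (isOscillator_resonant hs.ne' b t₀) hbnd (l := t₀) (r := t₁)
    (fun t ht => by
      rw [h.speed_eq ⟨ht.1, by linarith [ht.2]⟩, profile_of_mem ht₀pos hone ht, ← hrel]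
      ring)
    (by simp [hU0]) (by simp [hV0, growthExponent])
  -- the position on the resonance interval, in terms of the energy scale `ρ / lam`
  have hpos : ∀ t ∈ Icc t₀ t₁, lam * (lam ^ 2 * U t ^ 2) = ρ * (Real.sin (s * (t - t₀)) ^ 2 *
      (Real.exp (growthExponent (s * (t - t₀))) * Real.exp (-G)) ^ 2) := by
    intro t ht
    rw [(hexp t ht).1, mul_pow, div_pow, hb, ← hrel]
    field_simp
  -- `exp G` is the amplification over the whole resonance interval
  have hgrow : ∀ t ∈ Icc t₀ t₁, Real.exp (growthExponent (s * (t - t₀))) ≤ Real.exp G := by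
    intro t ht
    rw [hG, ← growthExponent_nat_mul_pi]
    exact Real.exp_le_exp.mpr
      (monotone_growthExponent ((mul_sub_le_iff_le_stopTime hs).mpr ht.2))
  have hmid : ∀ t ∈ Icc t₀ t₁, lam * (lam ^ 2 * U t ^ 2 + V t ^ 2) ≤ 2 * ρ := by
    intro t ht
    have e0 := hgrow t ht
    have e1 : lam * (lam ^ 2 * U t ^ 2) ≤ ρ := by
      rw [hpos t ht]
      have f1 : Real.exp (growthExponent (s * (t - t₀))) * Real.exp (-G) ≤ 1 := by
        calc _ ≤ Real.exp G * Real.exp (-G) :=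
              mul_le_mul_of_nonneg_right e0 (Real.exp_pos _).le
          _ = 1 := by rw [← Real.exp_add]; simp
      have f2 : (Real.exp (growthExponent (s * (t - t₀))) * Real.exp (-G)) ^ 2 ≤ 1 :=
        pow_le_one₀ (by positivity) f1
      have f3 := Real.sin_sq_le_one (s * (t - t₀))
      refine mul_le_of_le_one_right hρ.le (mul_le_one₀ f3 (by positivity) f2)
    have e2 : V t ^ 2 ≤ (5 / 4) ^ 2 * (d * ρ / lam) := by
      rw [(hexp t ht).2, mul_pow, mul_pow, ← hbsq]
      have f1 : |Real.cos (s * (t - t₀)) + Real.sin (s * (t - t₀)) ^ 3 / 4| ≤ 5 / 4 := by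
        have g1 := Real.abs_cos_le_one (s * (t - t₀))
        have g2 : |Real.sin (s * (t - t₀)) ^ 3 / 4| ≤ 1 / 4 := by
          rw [abs_div, abs_pow, abs_of_pos (by norm_num : (0 : ℝ) < 4)]
          have := pow_le_one₀ (n := 3) (abs_nonneg _) (Real.abs_sin_le_one (s * (t - t₀)))
          linarith
        linarith [abs_add_le (Real.cos (s * (t - t₀))) (Real.sin (s * (t - t₀)) ^ 3 / 4)]
      have f2 : (Real.cos (s * (t - t₀)) + Real.sin (s * (t - t₀)) ^ 3 / 4) ^ 2 ≤ (5 / 4) ^ 2 :=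
        sq_le_sq' (abs_le.mp f1).1 (abs_le.mp f1).2
      have f3 : Real.exp (growthExponent (s * (t - t₀))) ^ 2 ≤ Real.exp G ^ 2 :=
        pow_le_pow_left₀ (Real.exp_pos _).le e0 2
      have f4 := mul_le_mul f2 f3 (by positivity) (by positivity)
      have := mul_le_mul_of_nonneg_left f4 (sq_nonneg b)
      linarith
    have e3 : lam * V t ^ 2 ≤ (5 / 4) ^ 2 * (d * ρ) := by
      have := mul_le_mul_of_nonneg_left e2 hlam.le
      have e4 : lam * ((5 / 4) ^ 2 * (d * ρ / lam)) = (5 / 4) ^ 2 * (d * ρ) := by field_simp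
      linarith
    have e5 : d * ρ ≤ 1 / 2 * ρ := mul_le_mul_of_nonneg_right hd1 hρ.le
    rw [mul_add]
    linarith
  -- going back to time `0` costs at most `exp (s t₀)`, while `exp (2 G) ≥ exp (4 s t₀)`
  have hearly : ∀ t ∈ Icc 0 t₀, lam * (lam ^ 2 * U t ^ 2 + V t ^ 2) ≤
      ρ * Real.exp (-3 * (s * t₀)) := by
    intro t ht
    have e1 := hosc.energy_le hs (Λ := s) (l := 0) (r := t₀) (fun x hx => by
      have f1 := h.speed_le_of_le_node hx.2
      have f2 := h.speed_nonneg x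
      have f3 : speed τ σ δ x * lam ^ 2 ≤ 3 / 2 * s ^ 2 := by
        rw [← hrel]
        have := mul_le_mul_of_nonneg_right f1 (sq_nonneg lam)
        linarith
      have f4 : 0 ≤ speed τ σ δ x * lam ^ 2 := by positivity
      rw [abs_le]
      constructor <;> nlinarith [sq_nonneg s]) (right_mem_Icc.mpr ht₀pos.le) ht
    rw [hU0, hV0] at e1
    have e2 : Real.exp (s * |t - t₀|) ≤ Real.exp (s * t₀) := by
      refine Real.exp_le_exp.mpr (mul_le_mul_of_nonneg_left ?_ hs.le)
      rw [abs_of_nonpos (by linarith [ht.2])]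
      linarith [ht.1]
    have e3 : V t ^ 2 + s ^ 2 * U t ^ 2 ≤ b ^ 2 * Real.exp (s * t₀) := by
      have := mul_le_mul_of_nonneg_left e2 (sq_nonneg b)
      have e4 : b ^ 2 + s ^ 2 * (0 : ℝ) ^ 2 = b ^ 2 := by ring
      rw [e4] at e1
      exact e1.trans this
    have e5 : b ^ 2 * Real.exp (s * t₀) ≤ d * ρ / lam * Real.exp (-3 * (s * t₀)) := by
      rw [hb, mul_assoc, ← Real.exp_nat_mul, ← Real.exp_add]
      refine mul_le_mul_of_nonneg_left (Real.exp_le_exp.mpr ?_) (by positivity)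
      rw [hG]
      push_cast
      linarith
    rw [← hrel] at e3
    have e6 : d * (lam ^ 2 * U t ^ 2 + V t ^ 2) ≤ V t ^ 2 + lam ^ 2 * d * U t ^ 2 := by
      nlinarith [sq_nonneg (V t)]
    have e7 : d * (lam ^ 2 * U t ^ 2 + V t ^ 2) ≤ d * (ρ / lam * Real.exp (-3 * (s * t₀))) := by
      refine (e6.trans (e3.trans e5)).trans_eq ?_
      ring
    have e8 := mul_le_mul_of_nonneg_left (le_of_mul_le_mul_left e7 hd) hlam.le
    refine e8.trans_eq ?_
    field_simp
  have hs1 : s * (t₁ - t₀) = N * Real.pi := by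
    rw [ht₁, stopTime, add_sub_cancel_left, mul_div_cancel₀ _ hs.ne']
  have hU1 : U t₁ = 0 := by
    rw [(hexp t₁ ⟨ht01.le, le_rfl⟩).1, hs1, Real.sin_nat_mul_pi]
    ring
  have hV1 : V t₁ ^ 2 = d * ρ / lam := by
    have : Real.cos (N * Real.pi) ^ 2 = 1 := by
      have := Real.sin_sq_add_cos_sq (N * Real.pi)
      rw [Real.sin_nat_mul_pi] at this
      linarith
    rw [(hexp t₁ ⟨ht01.le, le_rfl⟩).2, hs1, Real.sin_nat_mul_pi, growthExponent_nat_mul_pi,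
      ← hbsq, zero_pow (by norm_num), zero_div, add_zero, mul_pow, mul_pow, this, one_mul]
  have hlate := fun t ht => h.late_energy hτ hosc hK hKσ hU1 (t := t) ht
  rw [hV1] at hlate
  have hρK : ρ ≤ ρ * Real.exp K := le_mul_of_one_le_right hρ.le (Real.one_le_exp hK)
  refine ⟨U, V, hosc, fun t ht => ?_, hearly 0 ⟨le_rfl, ht₀pos.le⟩, fun t ht => ?_, ?_⟩
  · rcases le_total t t₀ with h1 | h1
    · have e1 := hearly t ⟨ht.1, h1⟩
      have e2 : Real.exp (-3 * (s * t₀)) ≤ 1 := Real.exp_le_one_iff.mpr (by linarith)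
      have e3 := mul_le_of_le_one_right hρ.le e2
      linarith
    rcases le_total t t₁ with h2 | h2
    · have := hmid t ⟨h1, h2⟩
      linarith
    · have e1 := mul_le_mul_of_nonneg_left (hlate t ⟨h2, ht.2⟩).1 hlam.le
      have e2 : lam * (3 / 2 * (d * ρ / lam / d * Real.exp K)) = 3 / 2 * (ρ * Real.exp K) := by
        field_simp
      linarith
  · exact (hlate t ht).2
  · -- the last maximum of the position, a quarter of a turn before the stopping time
    have hpi := Real.pi_pos
    have hpi4 := Real.pi_lt_four
    have e1 : s * (t₀ + (N * Real.pi - Real.pi / 2) / s - t₀) = N * Real.pi - Real.pi / 2 := by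
      rw [add_sub_cancel_left, mul_div_cancel₀ _ hs.ne']
    have hmem : t₀ + (N * Real.pi - Real.pi / 2) / s ∈ Ioc t₀ t₁ := by
      refine ⟨?_, ?_⟩
      · have : 0 < (N * Real.pi - Real.pi / 2) / s := div_pos (by linarith) hs
        linarith
      · rw [← mul_sub_le_iff_le_stopTime hs, e1]
        linarith
    refine ⟨_, hmem, ?_⟩
    rw [hpos _ ⟨hmem.1.le, hmem.2⟩, e1, growthExponent_nat_mul_pi_sub]
    have e2 : Real.sin (N * Real.pi - Real.pi / 2) ^ 2 = 1 := by
      have := Real.sin_sq_add_cos_sq (N * Real.pi - Real.pi / 2)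
      rw [cos_nat_mul_pi_sub_pi_div_two] at this
      linarith
    have e3 : (Real.exp ((N * Real.pi - Real.pi / 2) / 8) * Real.exp (-G)) ^ 2 =
        Real.exp (-(Real.pi / 8)) := by
      rw [← Real.exp_add, ← Real.exp_nat_mul, hG]
      congr 1
      push_cast
      ring
    have e4 : 1 / 2 ≤ Real.exp (-(Real.pi / 8)) := by
      have := Real.add_one_le_exp (-(Real.pi / 8))
      linarith
    rw [e2, e3, one_mul]
    have := mul_le_mul_of_nonneg_left e4 hρ.le
    linarith

/-- The carrier mode: for a short time `u v ≥ 1 / 2`, so that `u²` increases with speed `≥ 1`. -/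
lemma exists_carrier {a : ℝ → ℝ} (ha : Continuous a) {M T : ℝ} (h0 : ∀ t, 0 ≤ a t)
    (hM : ∀ t, a t ≤ M) (hT : T * (4 * (1 + M)) ≤ 1) :
    ∃ u v : ℝ → ℝ, IsOscillator a u v ∧ u 0 = 1 ∧ v 0 = 1 ∧
      ∀ t ∈ Icc 0 T, |u t| ≤ 2 ∧ |v t| ≤ 2 ∧ 1 / 2 ≤ u t * v t := by
  have hM0 : 0 ≤ M := (h0 0).trans (hM 0)
  obtain ⟨u, v, hosc, hu0, hv0⟩ := exists_isOscillator ha (M := M)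
    (fun t => by rw [abs_of_nonneg (h0 t)]; exact hM t) 0 1 1
  have hb : ∀ t ∈ Icc 0 T, |u t| ≤ 2 ∧ |v t| ≤ 2 := by
    intro t ht
    have e1 := hosc.energy_le one_pos (Λ := 1 + M) (l := 0) (r := T) (fun x _ => by
      rw [abs_le]
      constructor <;> linarith [h0 x, hM x]) ⟨le_rfl, ht.1.trans ht.2⟩ ht
    rw [hu0, hv0, sub_zero, abs_of_nonneg ht.1] at e1
    have e2 : (1 + M) * t ≤ 1 / 4 := by nlinarith [ht.1, ht.2]
    have e3 : Real.exp ((1 + M) * t) ≤ 2 := by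
      have : Real.exp ((1 + M) * t) ≤ Real.exp (1 / 4) := Real.exp_le_exp.mpr e2
      have h4 : Real.exp (1 / 4) ^ 4 ≤ (2 : ℝ) ^ 4 := by
        rw [← Real.exp_nat_mul]
        norm_num
        linarith [Real.exp_one_lt_d9]
      linarith [le_of_pow_le_pow_left₀ (by norm_num) (by norm_num) h4]
    have e4 : v t ^ 2 + u t ^ 2 ≤ 4 := by nlinarith
    constructor
    · exact abs_le_of_sq_le_sq (by nlinarith [sq_nonneg (v t)]) (by norm_num)
    · exact abs_le_of_sq_le_sq (by nlinarith [sq_nonneg (u t)]) (by norm_num)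
  refine ⟨u, v, hosc, hu0, hv0, fun t ht => ⟨(hb t ht).1, (hb t ht).2, ?_⟩⟩
  have hv : ∀ x ∈ Icc 0 T, 1 / 2 ≤ v x := by
    intro x hx
    have e1 := abs_sub_le_of_hasDerivWithinAt (T := T) (v := v) (C := 2 * M)
      (fun s _ => (hosc.deriv_vel s).hasDerivWithinAt) (fun s hs => by
        rw [abs_neg, abs_mul, abs_of_nonneg (h0 s)]
        have := (hb s hs).1
        have := hM s
        have := h0 s
        have := abs_nonneg (u s)
        nlinarith) hx ⟨le_rfl, hx.1.trans hx.2⟩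
    rw [hv0, sub_zero, abs_of_nonneg hx.1] at e1
    have e2 : 2 * M * x ≤ 1 / 2 := by nlinarith [hx.1, hx.2]
    linarith [(abs_le.mp e1).1]
  have hu : 1 ≤ u t := by
    have mono : MonotoneOn u (Icc 0 T) := by
      refine monotoneOn_of_hasDerivWithinAt_nonneg (convex_Icc 0 T)
        hosc.continuous_pos.continuousOn (f' := v)
        (fun x _ => (hosc.deriv_pos x).hasDerivWithinAt) fun x hx => ?_
      linarith [hv x (interior_subset hx)]
    rw [← hu0]
    exact mono ⟨le_rfl, ht.1.trans ht.2⟩ ht ht.1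
  have := hv t ht
  nlinarith

end Modes

/-! ### Choice of the parameters -/

section Selection

lemma IsModulus.exists_frequency {ω : ℝ → ℝ} (hω : IsModulus ω) {L : ℝ}
    (hL : 1 / √(ω 1) ≤ L) : ∃ s, 1 ≤ s ∧ s / √(ω (1 / s)) = L := by
  have hω1 : 0 < √(ω 1) := Real.sqrt_pos.mpr (hω.pos 1 one_pos)
  set b := max 1 (L * √(ω 1))
  have hb : 1 ≤ b := le_max_left _ _
  have hcont : ContinuousOn (fun s => s / √(ω (1 / s))) (Icc 1 b) := by
    refine continuousOn_id.div (Real.continuous_sqrt.comp_continuousOn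
      (hω.continuousOn.comp ?_ fun s hs => ?_)) fun s hs => ?_
    · exact continuousOn_const.div continuousOn_id fun s hs => by
        have := hs.1
        positivity
    · have := hs.1
      exact mem_Ici.mpr (by positivity)
    · have := hs.1
      exact (Real.sqrt_pos.mpr (hω.pos _ (by positivity))).ne'
  have hmem : L ∈ Icc ((1 : ℝ) / √(ω (1 / 1))) (b / √(ω (1 / b))) := by
    refine ⟨by simpa using hL, ?_⟩
    have h1 : √(ω (1 / b)) ≤ √(ω 1) := Real.sqrt_le_sqrt
      (hω.monotoneOn (mem_Ici.mpr (by positivity)) (mem_Ici.mpr zero_le_one)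
        ((div_le_one (by positivity)).mpr hb))
    have h2 : 0 < √(ω (1 / b)) := Real.sqrt_pos.mpr (hω.pos _ (by positivity))
    rw [le_div_iff₀ h2]
    have hL0 : 0 ≤ L := le_trans (by positivity) hL
    exact (mul_le_mul_of_nonneg_left h1 hL0).trans (le_max_right _ _)
  obtain ⟨s, hs, e⟩ := intermediate_value_Icc hb hcont hmem
  exact ⟨s, hs.1, e⟩

/-- For every eigenvalue far enough in the sequence there are an amplitude `δ` and a frequency
`σ = √δ lam` such that an oscillation of amplitude `δ` and frequency `σ` is `ω`-continuous with the
small constant `η`, while `σ` is as large as wanted with respect to `φ lam`. -/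
lemma exists_amplitude_frequency {lam : ℕ → ℝ} (hlam : Tendsto lam atTop atTop) {ω : ℝ → ℝ}
    (hω : IsModulus ω) {φ : ℝ → ℝ} (hφ1 : ∀ σ, 0 ≤ σ → 1 ≤ φ σ)
    (hφ : Tendsto (fun σ => σ * (φ (σ / √(ω (1 / σ))))⁻¹) atTop atTop) {η : ℝ} (hη : 0 < η)
    (hη1 : η ≤ 1) (B : ℝ) :
    ∃ (n : ℕ) (σ δ : ℝ), B ≤ n ∧ B ≤ σ ∧ B ≤ lam n ∧ B ≤ lam n * δ ∧ 0 < δ ∧ B * δ ≤ 1 ∧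
      lam n ^ 2 * δ = σ ^ 2 ∧ δ ≤ η * ω (1 / σ) ∧ B * φ (lam n) ≤ σ := by
  have hω1 : 0 < ω 1 := hω.pos 1 one_pos
  have hex : ∀ L : ℝ, ∃ s, 1 / √(ω 1) ≤ L → 1 ≤ s ∧ s / √(ω (1 / s)) = L := by
    intro L
    by_cases hL : 1 / √(ω 1) ≤ L
    · obtain ⟨s, hs⟩ := hω.exists_frequency hL
      exact ⟨s, fun _ => hs⟩
    · exact ⟨0, fun h => absurd h hL⟩
  choose S hS using hex
  -- `S L / √(ω (1 / S L)) = L`, and `ω (1 / s) ≥ ω 1 / s` for `s ≥ 1`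
  have hsq : ∀ L, 1 / √(ω 1) ≤ L → L ^ 2 * ω (1 / S L) = S L ^ 2 ∧ ω 1 ≤ S L * ω (1 / S L) := by
    intro L hL
    obtain ⟨h1, h2⟩ := hS L hL
    have hs : 0 < S L := by linarith
    have hpos := hω.pos (1 / S L) (by positivity)
    constructor
    · nth_rewrite 1 [← h2]
      rw [div_pow, Real.sq_sqrt hpos.le, div_mul_cancel₀ _ hpos.ne']
    · have h3 := hω.mul_le (x := 1 / S L) (y := 1) (by positivity)
        ((div_le_one hs).mpr h1)
      rw [one_mul, div_mul_eq_mul_div, one_mul, div_le_iff₀ hs] at h3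
      linarith
  have hlarge : ∀ᶠ L : ℝ in atTop, 1 / √(ω 1) ≤ L := eventually_ge_atTop _
  have hStop : Tendsto S atTop atTop := by
    rw [tendsto_atTop]
    intro C
    have h1 : Tendsto (fun L : ℝ => L ^ 2 * ω 1) atTop atTop :=
      (tendsto_pow_atTop two_ne_zero).atTop_mul_const hω1
    filter_upwards [hlarge, h1.eventually_ge_atTop (C ^ 3)] with L hL hC
    by_contra hlt
    obtain ⟨e1, e2⟩ := hsq L hL
    have e3 := (hS L hL).1
    have e4 : S L ^ 3 < C ^ 3 :=
      pow_lt_pow_left₀ (not_le.mp hlt) (by linarith) (by norm_num)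
    have e5 : L ^ 2 * ω 1 ≤ L ^ 2 * (S L * ω (1 / S L)) :=
      mul_le_mul_of_nonneg_left e2 (sq_nonneg L)
    have e6 : L ^ 2 * (S L * ω (1 / S L)) = S L ^ 3 := by
      rw [mul_left_comm, e1]; ring
    linarith
  have hSn := hStop.comp hlam
  have hsη : 0 < √η := Real.sqrt_pos.mpr hη
  have hω0 : Tendsto (fun n => ω (1 / S (lam n))) atTop (𝓝 0) := by
    have h1 : Tendsto (fun n => 1 / S (lam n)) atTop (𝓝[Ici 0] 0) := by
      refine tendsto_nhdsWithin_iff.mpr ⟨?_, ?_⟩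
      · simp only [one_div]
        exact hSn.inv_tendsto_atTop
      · filter_upwards [hSn.eventually_ge_atTop 1] with n hn
        simp only [Function.comp_apply] at hn
        exact mem_Ici.mpr (by positivity)
    have h2 := (hω.continuousOn 0 (mem_Ici.mpr le_rfl)).tendsto.comp h1
    rwa [hω.map_zero] at h2
  have hB2 : Tendsto (fun n => η ^ 2 * ω 1 * S (lam n)) atTop atTop :=
    hSn.const_mul_atTop (by positivity)
  have hBδ : Tendsto (fun n => B * (η * ω (1 / S (lam n)))) atTop (𝓝 0) := by
    simpa using (hω0.const_mul η).const_mul B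
  obtain ⟨n, h1, h2, h3, h4, h5, h6, h7⟩ := ((tendsto_natCast_atTop_atTop.eventually_ge_atTop B).and
    ((hSn.eventually_ge_atTop (B / √η)).and ((hlam.eventually_ge_atTop B).and
    ((hB2.eventually_ge_atTop (B ^ 2)).and ((hBδ.eventually (gt_mem_nhds one_pos)).and
    (((hφ.comp hSn).eventually_ge_atTop (B / √η)).and (hlam.eventually hlarge))))))).exists
  obtain ⟨e1, e2⟩ := hsq _ h7
  obtain ⟨e3, e4⟩ := hS _ h7
  simp only [Function.comp_apply] at h2 h6
  have hL0 : 0 ≤ lam n := le_trans (by positivity) h7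
  set s := S (lam n)
  have hs : 0 < s := by linarith
  have hωs := hω.pos (1 / s) (by positivity)
  -- multiplying the amplitude by `η` lowers the resonant frequency from `s` to `√η s`
  refine ⟨n, √η * s, η * ω (1 / s), h1, ?_, h3, ?_, by positivity, h5.le, ?_, ?_, ?_⟩
  · rw [div_le_iff₀ hsη] at h2
    linarith
  · have e5 : B ^ 2 ≤ (lam n * (η * ω (1 / s))) ^ 2 := by
      refine h4.trans ?_
      calc η ^ 2 * ω 1 * s ≤ η ^ 2 * (s * ω (1 / s)) * s := by gcongr
        _ = η ^ 2 * ω (1 / s) * s ^ 2 := by ring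
        _ = η ^ 2 * ω (1 / s) * (lam n ^ 2 * ω (1 / s)) := by rw [e1]
        _ = _ := by ring
    exact le_of_abs_le (abs_le_of_sq_le_sq e5 (by positivity))
  · rw [mul_left_comm, e1, mul_pow, Real.sq_sqrt hη.le]
  · refine mul_le_mul_of_nonneg_left (hω.monotoneOn (mem_Ici.mpr (by positivity))
      (mem_Ici.mpr (by positivity)) ?_) hη.le
    refine one_div_le_one_div_of_le (by positivity) ?_
    exact mul_le_of_le_one_left hs.le (Real.sqrt_le_one.mpr hη1)
  · have hφp := hφ1 (lam n) hL0
    rw [e4, ← div_eq_mul_inv, le_div_iff₀ (by linarith), div_mul_eq_mul_div,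
      div_le_iff₀ hsη] at h6
    linarith

/-- The parameters of the construction: the modes `n k`, the frequencies `σ k` and amplitudes `δ k`
of the speed, the bounds `K k` for the rate of decrease of the speed after the `k`-th oscillation,
and the sizes `ρ k` of the modes. -/
structure IsDesign (τ κ : ℝ) (lam : ℕ → ℝ) (ω φ : ℝ → ℝ) (n : ℕ → ℕ) (σ δ K ρ : ℕ → ℝ) : Prop where
  staging : IsStaging τ σ δ
  strictMono : StrictMono n
  index_pos : ∀ k, 0 < n k
  rate_nonneg : ∀ k, 0 ≤ K k
  rate : ∀ k, ∀ j < k, 20 * σ j ≤ K k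
  size : ∀ k, ρ k = κ * (1 / 4) ^ k * Real.exp (-K k)
  resonance : ∀ k, lam (n k) ^ 2 * δ k = σ k ^ 2
  modulus : ∀ k, δ k ≤ (1 / 2) ^ k * ω (1 / σ k)
  gevrey : ∀ k, (k + 1) * φ (lam (n k)) ≤ σ k * node τ k
  one_le : ∀ k, 1 ≤ lam (n k)
  derivative_loss : ∀ k, 1 ≤ lam (n k) * δ k * (ρ k * Real.exp (-K k))
  blowup : ∀ k, ((k + 1) / ρ k) ^ (k + 1) ≤ lam (n k)

/-- The parameters are chosen recursively: all requirements on the `k`-th mode hold for every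
eigenvalue far enough in the sequence, how far depending on the previous choices only. -/
lemma exists_isDesign {τ κ : ℝ} (hτ : 0 < τ) (hκ : 0 < κ) {lam : ℕ → ℝ}
    (hlam0 : ∀ k, 0 < lam k) (hlam : Tendsto lam atTop atTop) {ω : ℝ → ℝ} (hω : IsModulus ω)
    {φ : ℝ → ℝ} (hφ1 : ∀ σ, 0 ≤ σ → 1 ≤ φ σ)
    (hφ : Tendsto (fun σ => σ * (φ (σ / √(ω (1 / σ))))⁻¹) atTop atTop) :
    ∃ n σ δ K ρ, IsDesign τ κ lam ω φ n σ δ K ρ := by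
  -- a state consists of an index, a frequency and an amplitude
  let size : ℕ → ℝ → ℝ := fun k s => κ * (1 / 4) ^ k * Real.exp (-(20 * s))
  have hsize : ∀ k s, 0 < size k s := fun k s => by positivity
  have step : ∀ (k : ℕ) (x : ℕ × ℝ × ℝ), ∃ y : ℕ × ℝ × ℝ, x.1 < y.1 ∧ x.2.1 ≤ y.2.1 ∧
      0 < y.2.2 ∧ (0 < x.2.2 → y.2.2 ≤ x.2.2 / 4) ∧ lam y.1 ^ 2 * y.2.2 = y.2.1 ^ 2 ∧
      y.2.2 ≤ (1 / 2) ^ k * ω (1 / y.2.1) ∧ (k + 1) * φ (lam y.1) ≤ y.2.1 * node τ k ∧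
      1 ≤ lam y.1 ∧ 1 ≤ lam y.1 * y.2.2 * (size k x.2.1 * Real.exp (-(20 * x.2.1))) ∧
      ((k + 1) / size k x.2.1) ^ (k + 1) ≤ lam y.1 := by
    rintro k ⟨n, s, d⟩
    have hnode : 0 < node τ k := div_pos hτ (by positivity)
    obtain ⟨B, b1, b2, b3, b4, b5, b6, b7⟩ := ((eventually_ge_atTop ((n : ℝ) + 1)).and
      ((eventually_ge_atTop s).and ((eventually_ge_atTop (4 / d)).and
      ((eventually_ge_atTop (((k : ℝ) + 1) / node τ k)).and ((eventually_ge_atTop (1 : ℝ)).and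
      ((eventually_ge_atTop (1 / (size k s * Real.exp (-(20 * s))))).and
      (eventually_ge_atTop (((k + 1) / size k s) ^ (k + 1))))))))).exists
    obtain ⟨n', s', d', c1, c2, c3, c4, c5, c6, c7, c8, c9⟩ :=
      exists_amplitude_frequency hlam hω hφ1 hφ (η := (1 / 2) ^ k) (by positivity)
        (pow_le_one₀ (by norm_num) (by norm_num)) B
    refine ⟨⟨n', s', d'⟩, ?_, b2.trans c2, c5, fun hd => ?_, c7, c8, ?_, b5.trans c3, ?_,
      b7.trans c3⟩
    · have : (n : ℝ) < n' := by linarith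
      exact_mod_cast this
    · simp only at hd ⊢
      rw [div_le_iff₀ hd] at b3
      nlinarith
    · simp only
      rw [div_le_iff₀ hnode] at b4
      have hφp := hφ1 (lam n') (hlam0 n').le
      have e1 := mul_le_mul_of_nonneg_right b4 (by linarith : 0 ≤ φ (lam n'))
      have e2 := mul_le_mul_of_nonneg_right c9 hnode.le
      linarith
    · have hp : 0 < size k s * Real.exp (-(20 * s)) := mul_pos (hsize k s) (Real.exp_pos _)
      rw [div_le_iff₀ hp] at b6
      exact b6.trans (mul_le_mul_of_nonneg_right c4 hp.le)
  choose next hnext using step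
  -- the initial state is a dummy: its frequency `0` gives `K 0 = 0`, its amplitude `2` gives
  -- `δ 0 ≤ 1 / 2`
  let p : ℕ → ℕ × ℝ × ℝ := fun k => Nat.rec (0, 0, 2) (fun k x => next k x) k
  have hp : ∀ k, p (k + 1) = next k (p k) := fun k => rfl
  have hR := fun k => hnext k (p k)
  simp only [← hp] at hR
  have hδ : ∀ k, 0 < (p k).2.2 := by
    rintro (_ | k)
    · exact two_pos
    · exact (hR k).2.2.1
  have hmono : Monotone fun k => (p k).2.1 := monotone_nat_of_le_succ fun k => (hR k).2.1
  have hn : StrictMono fun k => (p k).1 := strictMono_nat_of_lt_succ fun k => (hR k).1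
  have hnode : ∀ k, 0 < node τ k := fun k => div_pos hτ (by positivity)
  refine ⟨fun k => (p (k + 1)).1, fun k => (p (k + 1)).2.1, fun k => (p (k + 1)).2.2,
    fun k => 20 * (p k).2.1, fun k => size k (p k).2.1,
    ⟨hτ, fun k => hδ (k + 1), ?_, fun k => (hR (k + 1)).2.2.2.1 (hδ (k + 1)),
      fun a b hab => hmono (Nat.succ_le_succ hab), fun k => ?_⟩,
    fun a b hab => hn (Nat.succ_lt_succ hab), fun k => ?_, fun k => ?_, fun k j hj => ?_,
    fun k => rfl, fun k => (hR k).2.2.2.2.1, fun k => (hR k).2.2.2.2.2.1,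
    fun k => (hR k).2.2.2.2.2.2.1, fun k => (hR k).2.2.2.2.2.2.2.1,
    fun k => (hR k).2.2.2.2.2.2.2.2.1, fun k => (hR k).2.2.2.2.2.2.2.2.2⟩
  · have := (hR 0).2.2.2.1 two_pos
    refine this.trans ?_
    change (2 : ℝ) / 4 ≤ 1 / 2
    norm_num
  · have e1 := (hR k).2.2.2.2.2.2.1
    have e2 := hφ1 (lam (p (k + 1)).1) (hlam0 _).le
    have e3 : (0 : ℝ) ≤ k := Nat.cast_nonneg k
    nlinarith
  · exact (Nat.zero_le _).trans_lt (hR k).1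
  · have : (p 0).2.1 ≤ (p k).2.1 := hmono (Nat.zero_le k)
    have h0 : (p 0).2.1 = 0 := rfl
    linarith
  · have : (p (j + 1)).2.1 ≤ (p k).2.1 := hmono hj
    linarith

end Selection

/-! ### From the modes to the solution -/

section Assembly

lemma IsModulus.mul_nat_le {ω : ℝ → ℝ} (hω : IsModulus ω) (n : ℕ) {x : ℝ} (hx : 0 ≤ x) :
    ω (n * x) ≤ n * ω x := by
  induction n with
  | zero => simp [hω.map_zero]
  | succ n ih =>
    have h1 := hω.add_le (n * x) x (by positivity) hx
    push_cast
    rw [add_mul, one_mul, add_mul, one_mul]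
    linarith

/-- A function that increases at least at the rate `q` on `[0, T]` has a globally Lipschitz left
inverse. -/
lemma exists_lipschitz_leftInverse {ψ : ℝ → ℝ} {T q : ℝ} (hq : 0 < q)
    (hψ : ∀ a ∈ Icc 0 T, ∀ b ∈ Icc 0 T, a ≤ b → q * (b - a) ≤ ψ b - ψ a) :
    ∃ Θ : ℝ → ℝ, (∀ x y, |Θ x - Θ y| ≤ q⁻¹ * |x - y|) ∧ ∀ t ∈ Icc 0 T, Θ (ψ t) = t := by
  have key : ∀ a ∈ Icc 0 T, ∀ b ∈ Icc 0 T, |a - b| ≤ q⁻¹ * |ψ a - ψ b| := by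
    intro a ha b hb
    rw [le_inv_mul_iff₀ hq]
    rcases le_total a b with h | h
    · have h1 := hψ a ha b hb h
      rw [abs_sub_comm, abs_of_nonneg (sub_nonneg.mpr h), abs_sub_comm]
      exact h1.trans (le_abs_self _)
    · have h1 := hψ b hb a ha h
      rw [abs_of_nonneg (sub_nonneg.mpr h)]
      exact h1.trans (le_abs_self _)
  have hinj : InjOn ψ (Icc 0 T) := by
    intro a ha b hb hab
    have := key a ha b hb
    rw [hab, sub_self, abs_zero, mul_zero] at this
    exact sub_eq_zero.mp (abs_nonpos_iff.mp this)
  have hinv : ∀ t ∈ Icc 0 T, Function.invFunOn ψ (Icc 0 T) (ψ t) = t := fun t ht =>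
    hinj.leftInvOn_invFunOn ht
  have hlip : LipschitzOnWith q⁻¹.toNNReal (Function.invFunOn ψ (Icc 0 T)) (ψ '' Icc 0 T) := by
    refine LipschitzOnWith.of_dist_le_mul ?_
    rintro _ ⟨a, ha, rfl⟩ _ ⟨b, hb, rfl⟩
    rw [hinv a ha, hinv b hb, Real.coe_toNNReal _ (inv_nonneg.mpr hq.le), Real.dist_eq,
      Real.dist_eq]
    exact key a ha b hb
  obtain ⟨Θ, h1, h2⟩ := hlip.extend_real
  refine ⟨Θ, fun x y => ?_, fun t ht => ?_⟩
  · have := h1.dist_le_mul x y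
    rwa [Real.coe_toNNReal _ (inv_nonneg.mpr hq.le), Real.dist_eq, Real.dist_eq] at this
  · rw [← h2 ⟨t, ht, rfl⟩, hinv t ht]

/-- A family of modes `V j` of frequencies `μ j`, all driven by the speed `c`, whose norms in
`D(A^{3/4}) × D(A^{1/4})` are bounded by a summable sequence on `[0, T]`. -/
structure IsModeFamily (μ : ℕ → ℝ) (c : ℝ → ℝ) (T : ℝ) (V V' : ℕ → ℝ → ℝ) (B : ℕ → ℝ) : Prop where
  osc : ∀ j, IsOscillator (fun t => c t * μ j ^ 2) (V j) (V' j)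
  nonneg : ∀ j, 0 ≤ B j
  summable : Summable B
  bound : ∀ j, ∀ t ∈ Icc 0 T, μ j * (μ j ^ 2 * V j t ^ 2 + V' j t ^ 2) ≤ B j ^ 2

variable {μ : ℕ → ℝ} {c : ℝ → ℝ} {T : ℝ} {V V' : ℕ → ℝ → ℝ} {B : ℕ → ℝ}

namespace IsModeFamily

variable (hV : IsModeFamily μ c T V V' B) {m₀ : ℝ} (hm₀ : 0 < m₀) (hμ : ∀ j, m₀ ≤ μ j)

include hV

lemma summable_sq : Summable fun j => B j ^ 2 :=
  summable_sq_of_abs (hV.summable.congr fun j => (abs_of_nonneg (hV.nonneg j)).symm)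

include hm₀ hμ

lemma abs_pos_le (j : ℕ) {t : ℝ} (ht : t ∈ Icc 0 T) : |V j t| ≤ B j / √(μ j ^ 3) := by
  have hpos : 0 < μ j := hm₀.trans_le (hμ j)
  refine abs_le_of_sq_le_sq ?_ (div_nonneg (hV.nonneg j) (Real.sqrt_nonneg _))
  rw [div_pow, Real.sq_sqrt (by positivity), le_div_iff₀ (by positivity)]
  have h1 := hV.bound j t ht
  have h2 : 0 ≤ μ j * V' j t ^ 2 := by positivity
  nlinarith

lemma abs_vel_le (j : ℕ) {t : ℝ} (ht : t ∈ Icc 0 T) : |V' j t| ≤ B j / √(μ j) := by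
  have hpos : 0 < μ j := hm₀.trans_le (hμ j)
  refine abs_le_of_sq_le_sq ?_ (div_nonneg (hV.nonneg j) (Real.sqrt_nonneg _))
  rw [div_pow, Real.sq_sqrt hpos.le, le_div_iff₀ hpos]
  have h1 := hV.bound j t ht
  have h2 : 0 ≤ μ j * (μ j ^ 2 * V j t ^ 2) := by positivity
  nlinarith

lemma summable_pos_bound : Summable fun j => B j / √(μ j ^ 3) := by
  refine Summable.of_nonneg_of_le (fun j => div_nonneg (hV.nonneg j) (Real.sqrt_nonneg _))
    (fun j => ?_) (hV.summable.div_const √(m₀ ^ 3))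
  exact div_le_div_of_nonneg_left (hV.nonneg j) (Real.sqrt_pos.mpr (by positivity))
    (Real.sqrt_le_sqrt (pow_le_pow_left₀ hm₀.le (hμ j) 3))

lemma summable_vel_bound : Summable fun j => B j / √(μ j) := by
  refine Summable.of_nonneg_of_le (fun j => div_nonneg (hV.nonneg j) (Real.sqrt_nonneg _))
    (fun j => ?_) (hV.summable.div_const √m₀)
  exact div_le_div_of_nonneg_left (hV.nonneg j) (Real.sqrt_pos.mpr hm₀)
    (Real.sqrt_le_sqrt (hμ j))

lemma summable_abs_pos {t : ℝ} (ht : t ∈ Icc 0 T) : Summable fun j => |V j t| :=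
  Summable.of_nonneg_of_le (fun _ => abs_nonneg _) (fun j => hV.abs_pos_le hm₀ hμ j ht)
    (hV.summable_pos_bound hm₀ hμ)

lemma summable_abs_vel {t : ℝ} (ht : t ∈ Icc 0 T) : Summable fun j => |V' j t| :=
  Summable.of_nonneg_of_le (fun _ => abs_nonneg _) (fun j => hV.abs_vel_le hm₀ hμ j ht)
    (hV.summable_vel_bound hm₀ hμ)

lemma summable_pos_weight_three : Summable fun j =>
    (B j / √(μ j ^ 3)) ^ 2 * (μ j ^ 2) ^ (2 * (3 / 4) : ℝ) := by
  refine hV.summable_sq.congr fun j => ?_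
  have hpos : 0 < μ j := hm₀.trans_le (hμ j)
  have h1 : (μ j ^ 2) ^ (2 * (3 / 4) : ℝ) = μ j ^ 3 := by
    rw [← Real.rpow_natCast_mul hpos.le, ← Real.rpow_natCast (μ j) 3]
    norm_num
  rw [h1, div_pow, Real.sq_sqrt (by positivity), div_mul_cancel₀ _ (by positivity)]

lemma summable_vel_weight_one : Summable fun j =>
    (B j / √(μ j)) ^ 2 * (μ j ^ 2) ^ (2 * (1 / 4) : ℝ) := by
  refine hV.summable_sq.congr fun j => ?_
  have hpos : 0 < μ j := hm₀.trans_le (hμ j)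
  have h1 : (μ j ^ 2) ^ (2 * (1 / 4) : ℝ) = μ j := by
    rw [← Real.rpow_natCast_mul hpos.le]
    norm_num
  rw [h1, div_pow, Real.sq_sqrt (by positivity), div_mul_cancel₀ _ (by positivity)]

lemma summable_pos_weight_one : Summable fun j =>
    (B j / √(μ j ^ 3)) ^ 2 * (μ j ^ 2) ^ (2 * (1 / 4) : ℝ) := by
  refine Summable.of_nonneg_of_le (fun j => by positivity) (fun j => ?_)
    (hV.summable_sq.div_const (m₀ ^ 2))
  have hpos : 0 < μ j := hm₀.trans_le (hμ j)
  have h1 : (μ j ^ 2) ^ (2 * (1 / 4) : ℝ) = μ j := by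
    rw [← Real.rpow_natCast_mul hpos.le]
    norm_num
  rw [h1, div_pow, Real.sq_sqrt (by positivity)]
  have h2 : B j ^ 2 / μ j ^ 3 * μ j = B j ^ 2 / μ j ^ 2 := by field_simp
  rw [h2]
  exact div_le_div_of_nonneg_left (sq_nonneg _) (by positivity)
    (pow_le_pow_left₀ hm₀.le (hμ j) 2)

lemma summable_pos_weight_two {t : ℝ} (ht : t ∈ Icc 0 T) :
    Summable fun j => μ j ^ 2 * V j t ^ 2 := by
  refine Summable.of_nonneg_of_le (fun j => by positivity) (fun j => ?_)
    (hV.summable_sq.div_const m₀)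
  have hpos : 0 < μ j := hm₀.trans_le (hμ j)
  have h1 := hV.bound j t ht
  rw [le_div_iff₀ hm₀]
  have h2 : 0 ≤ μ j * V' j t ^ 2 := by positivity
  have h3 : 0 ≤ μ j ^ 2 * V j t ^ 2 := by positivity
  nlinarith [hμ j]

end IsModeFamily

variable {H : Type*} [NormedAddCommGroup H] [InnerProductSpace ℝ H] [CompleteSpace H]
  {A : H →ₗ.[ℝ] H} {f : ℕ → H}

lemma IsModeFamily.regularity (hV : IsModeFamily μ c T V V' B) (hA : IsSelfAdjoint A)
    (hA0 : IsNonneg A) (h : IsEigenSystem A f μ) {m₀ : ℝ} (hm₀ : 0 < m₀) (hμ : ∀ j, m₀ ≤ μ j) :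
    ContDiffInto A (1 / 4) T (fun t => superpose f fun j => V j t)
      (fun t => superpose f fun j => V' j t) ∧
    ContinuousInto A (3 / 4) T (fun t => superpose f fun j => V j t) :=
  ⟨contDiffInto_superpose hA hA0 h (hV.summable_pos_bound hm₀ hμ)
      (hV.summable_pos_weight_one hm₀ hμ) (hV.summable_vel_bound hm₀ hμ)
      (hV.summable_vel_weight_one hm₀ hμ)
      (fun j t _ => ((hV.osc j).deriv_pos t).hasDerivWithinAt)
      (fun j => (hV.osc j).continuous_vel.continuousOn)
      (fun j _ ht => hV.abs_pos_le hm₀ hμ j ht) (fun j _ ht => hV.abs_vel_le hm₀ hμ j ht),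
    continuousInto_superpose hA hA0 h (hV.summable_pos_bound hm₀ hμ)
      (hV.summable_pos_weight_three hm₀ hμ)
      (fun j => (hV.osc j).continuous_pos.continuousOn)
      (fun j _ ht => hV.abs_pos_le hm₀ hμ j ht)⟩

lemma IsModeFamily.sq_powNorm_half (hV : IsModeFamily μ c T V V' B) (hA : IsSelfAdjoint A)
    (hA0 : IsNonneg A) (h : IsEigenSystem A f μ) {m₀ : ℝ} (hm₀ : 0 < m₀) (hμ : ∀ j, m₀ ≤ μ j)
    {t : ℝ} (ht : t ∈ Icc 0 T) :
    (powNorm A (1 / 2) (superpose f fun j => V j t)).toReal ^ 2 =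
      ∑' j, μ j ^ 2 * V j t ^ 2 := by
  have h1 : ∀ j, V j t ^ 2 * (μ j ^ 2) ^ (2 * (1 / 2) : ℝ) = μ j ^ 2 * V j t ^ 2 := fun j => by
    norm_num
    ring
  have h0 : 0 ≤ ∑' j, μ j ^ 2 * V j t ^ 2 := tsum_nonneg fun j => by positivity
  rw [powNorm_superpose_of_summable hA hA0 h (hV.summable_abs_pos hm₀ hμ ht)
    ((hV.summable_pos_weight_two hm₀ hμ ht).congr fun j => (h1 j).symm)]
  simp only [h1]
  rw [ENNReal.toReal_ofReal (by positivity), ← Real.sqrt_eq_rpow, Real.sq_sqrt h0]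

/-- If the mode of index `0` dominates the others, `|A^{1/2} u|²` increases at a positive rate. -/
lemma IsModeFamily.increase (hV : IsModeFamily μ c T V V' B) {m₀ : ℝ} (hm₀ : 0 < m₀)
    (hμ : ∀ j, m₀ ≤ μ j) (h0 : ∀ t ∈ Icc 0 T, 1 / 2 ≤ V 0 t * V' 0 t) {q : ℝ}
    (hq : q + ∑' j, B (j + 1) ^ 2 ≤ μ 0 ^ 2) :
    ∀ a ∈ Icc 0 T, ∀ b ∈ Icc 0 T, a ≤ b →
      q * (b - a) ≤ (∑' j, μ j ^ 2 * V j b ^ 2) - ∑' j, μ j ^ 2 * V j a ^ 2 := by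
  intro a ha b hb hab
  have hsa := hV.summable_pos_weight_two hm₀ hμ ha
  have hsb := hV.summable_pos_weight_two hm₀ hμ hb
  have hs2 := (summable_nat_add_iff 1).mpr hV.summable_sq
  have hderiv : ∀ j t, HasDerivAt (fun t => V j t ^ 2) (2 * (V j t * V' j t)) t := by
    intro j t
    refine (((hV.osc j).deriv_pos t).pow 2).congr_deriv ?_
    simp
    ring
  have hmain : b - a ≤ V 0 b ^ 2 - V 0 a ^ 2 := by
    have mono : MonotoneOn (fun t => V 0 t ^ 2 - t) (Icc 0 T) := by
      refine monotoneOn_of_hasDerivWithinAt_nonneg (convex_Icc 0 T)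
        (f' := fun t => 2 * (V 0 t * V' 0 t) - 1) ?_
        (fun t _ => ((hderiv 0 t).sub (hasDerivAt_id t)).hasDerivWithinAt) fun t ht => ?_
      · have := (hV.osc 0).continuous_pos
        fun_prop
      · linarith [h0 t (interior_subset ht)]
    have := mono ha hb hab
    simp only at this
    linarith
  have hrest : ∀ j, -(B (j + 1) ^ 2 * (b - a)) ≤
      μ (j + 1) ^ 2 * V (j + 1) b ^ 2 - μ (j + 1) ^ 2 * V (j + 1) a ^ 2 := by
    intro j
    have hpos : 0 < μ (j + 1) := hm₀.trans_le (hμ _)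
    have h1 := abs_sub_le_of_hasDerivWithinAt (T := T)
      (v := fun t => μ (j + 1) ^ 2 * V (j + 1) t ^ 2) (C := B (j + 1) ^ 2)
      (fun t _ => ((hderiv (j + 1) t).const_mul (μ (j + 1) ^ 2)).hasDerivWithinAt)
      (fun t ht => by
        refine le_trans ?_ (hV.bound (j + 1) t ht)
        have e1 : μ (j + 1) ^ 2 * (2 * (V (j + 1) t * V' (j + 1) t)) =
          μ (j + 1) * (2 * (μ (j + 1) * V (j + 1) t) * V' (j + 1) t) := by ring
        rw [e1, abs_mul, abs_of_pos hpos]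
        refine mul_le_mul_of_nonneg_left ?_ hpos.le
        rw [abs_le]
        constructor <;> nlinarith [sq_nonneg (μ (j + 1) * V (j + 1) t + V' (j + 1) t),
          sq_nonneg (μ (j + 1) * V (j + 1) t - V' (j + 1) t)]) hb ha
    rw [abs_of_nonneg (sub_nonneg.mpr hab)] at h1
    exact (abs_le.mp h1).1
  have hsum := (hs2.mul_right (b - a)).neg.tsum_le_tsum hrest
    (((summable_nat_add_iff 1).mpr hsb).sub ((summable_nat_add_iff 1).mpr hsa))
  rw [tsum_neg, tsum_mul_right, ((summable_nat_add_iff 1).mpr hsb).tsum_sub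
    ((summable_nat_add_iff 1).mpr hsa)] at hsum
  rw [hsb.tsum_eq_zero_add, hsa.tsum_eq_zero_add]
  have e1 := mul_le_mul_of_nonneg_left hmain (sq_nonneg (μ 0))
  have e2 := mul_le_mul_of_nonneg_right hq (sub_nonneg.mpr hab)
  linarith

end Assembly

/-! ### Loss of regularity -/

section Loss

variable {μ : ℕ → ℝ} {c : ℝ → ℝ} {T : ℝ} {V V' : ℕ → ℝ → ℝ} {B : ℕ → ℝ}
  {H : Type*} [NormedAddCommGroup H] [InnerProductSpace ℝ H] [CompleteSpace H]
  {A : H →ₗ.[ℝ] H} {f : ℕ → H}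

lemma superpose_not_mem_phaseSpace (hA : IsSelfAdjoint A) (hA0 : IsNonneg A)
    (h : IsEigenSystem A f μ) {a b : ℕ → ℝ} (ha : Summable fun j => |a j|)
    (hb : Summable fun j => |b j|) {ε : ℝ} (hε : 0 < ε)
    (hlow : ∀ᶠ j in atTop, 1 ≤ μ j ∧ ε ≤ μ j ^ 2 * (μ j ^ 2 * a j ^ 2 + b j ^ 2)) {β : ℝ}
    (hβ : 1 ≤ β) : (superpose f a, superpose f b) ∉ phaseSpace A β := by
  rintro ⟨h1, h2⟩
  have s1 := summable_of_superpose_mem_powDomain hA hA0 h ha h1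
  have s2 := summable_of_superpose_mem_powDomain hA hA0 h hb h2
  have hlim := (s1.add s2).tendsto_atTop_zero
  obtain ⟨j, ⟨hj1, hj2⟩, hj3⟩ := (hlow.and (hlim.eventually (gt_mem_nhds hε))).exists
  have hsq : 1 ≤ μ j ^ 2 := one_le_pow₀ hj1
  have e1 : μ j ^ 2 ≤ (μ j ^ 2) ^ β := by
    simpa using Real.rpow_le_rpow_of_exponent_le hsq hβ
  have e2 : (μ j ^ 2) ^ (2 * ((β + 1) / 2)) = (μ j ^ 2) ^ β * μ j ^ 2 := by
    rw [mul_div_cancel₀ _ two_ne_zero, Real.rpow_add_one (by positivity)]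
  have e3 : (μ j ^ 2) ^ (2 * (β / 2)) = (μ j ^ 2) ^ β := by
    rw [mul_div_cancel₀ _ two_ne_zero]
  rw [e2, e3] at hj3
  have e4 : 0 ≤ μ j ^ 2 * a j ^ 2 + b j ^ 2 := by positivity
  have e5 := mul_le_mul_of_nonneg_right e1 e4
  linarith

/-- The eigenvalues grow so fast that every positive power of them compensates the size `ρ k` of
the modes. -/
lemma IsDesign.le_rpow {τ κ : ℝ} {lam : ℕ → ℝ} {ω φ : ℝ → ℝ} {n : ℕ → ℕ} {σ δ K ρ : ℕ → ℝ}
    (D : IsDesign τ κ lam ω φ n σ δ K ρ) (hρ : ∀ k, 0 < ρ k) {γ : ℝ} {k : ℕ}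
    (hγ : 1 ≤ γ * (k + 1)) : (k : ℝ) + 1 ≤ ρ k * lam (n k) ^ γ := by
  have h1 := D.blowup k
  have hk : (0 : ℝ) < k + 1 := by positivity
  have hx : 0 ≤ ((k : ℝ) + 1) / ρ k := div_nonneg hk.le (hρ k).le
  have h2 : ((k : ℝ) + 1) / ρ k ≤ lam (n k) ^ ((k : ℝ) + 1)⁻¹ := by
    calc ((k : ℝ) + 1) / ρ k = ((((k : ℝ) + 1) / ρ k) ^ (k + 1)) ^ ((k : ℝ) + 1)⁻¹ := by
          rw [← Real.rpow_natCast, ← Real.rpow_mul hx]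
          push_cast
          rw [mul_inv_cancel₀ hk.ne', Real.rpow_one]
      _ ≤ _ := Real.rpow_le_rpow (by positivity) h1 (by positivity)
  have h3 : ((k : ℝ) + 1)⁻¹ ≤ γ := by
    rw [inv_le_iff_one_le_mul₀ hk]
    linarith
  have h4 := h2.trans (Real.rpow_le_rpow_of_exponent_le (D.one_le k) h3)
  rw [div_le_iff₀ (hρ k)] at h4
  linarith

end Loss

/-- The sequence `a, s 0, s 1, …`. -/
def consSeq {α : Type*} (a : α) (s : ℕ → α) : ℕ → α
  | 0 => a
  | k + 1 => s k

lemma summable_consSeq {a : ℝ} {s : ℕ → ℝ} (hs : Summable s) : Summable (consSeq a s) :=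
  (summable_nat_add_iff 1).mp hs

end Kirchhoff

open Kirchhoff in
theorem theorem3p2 {H : Type*} [NormedAddCommGroup H] [InnerProductSpace ℝ H] [CompleteSpace H]
    (A : H →ₗ.[ℝ] H) (hA : IsSelfAdjoint A) (hA0 : IsNonneg A)
    (e : ℕ → H) (he : Orthonormal ℝ e) (lam : ℕ → ℝ) (hlam_pos : ∀ k, 0 < lam k)
    (hlam_mono : Monotone lam) (hlam_unbdd : ¬ BddAbove (range lam))
    (hdom : ∀ k, e k ∈ A.domain) (heig : ∀ k, A ⟨e k, hdom k⟩ = (lam k) ^ 2 • e k)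
    (ω : ℝ → ℝ) (hω : IsModulus ω)
    (φ : ℝ → ℝ) (hφ1 : ∀ σ, 0 ≤ σ → 1 ≤ φ σ)
    (hφ : Tendsto (fun σ => σ * (φ (σ / √(ω (1 / σ))))⁻¹) atTop atTop) :
    ∃ (m : ℝ → ℝ) (T₀ : ℝ) (u u' : ℝ → H),
      (∀ σ, 0 ≤ σ → m σ ∈ Icc (0 : ℝ) (3 / 2)) ∧ 0 < T₀ ∧
      OmegaContinuousOn ω m (Ici 0) ∧
      (∀ r, 0 < r → u 0 ∈ gevreySpace A φ r (3 / 4) ∧ u' 0 ∈ gevreySpace A φ r (1 / 4)) ∧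
      (ContDiffInto A (1 / 4) T₀ u u' ∧ ContinuousInto A (3 / 4) T₀ u ∧
        SolvesKirchhoff A m T₀ u u') ∧
      (∀ t ∈ Ioc 0 T₀, ∀ β, 1 ≤ β → (u t, u' t) ∉ phaseSpace A β) ∧
      (∃ τ : ℕ → ℝ, (∀ k, τ k ∈ Ioc 0 T₀) ∧ Tendsto τ atTop (𝓝 0) ∧
        ∀ β, 1 / 2 < β → ∀ C : ℝ≥0, ∃ᶠ k in atTop, (C : ℝ≥0∞) < powNorm A ((β + 1) / 2) (u (τ k))) := by
  have hlam : Tendsto lam atTop atTop := tendsto_atTop_atTop_of_monotone hlam_mono fun b => by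
    by_contra hc
    push Not at hc
    exact hlam_unbdd ⟨b, by rintro _ ⟨k, rfl⟩; exact (hc k).le⟩
  have hl0 := hlam_pos 0
  obtain ⟨τ, hτ⟩ : ∃ τ : ℝ, τ = 1 / (32 * (4 * (1 + 3 / 2 * lam 0 ^ 2))) := ⟨_, rfl⟩
  have hτ0 : 0 < τ := by rw [hτ]; positivity
  have hT : 32 * τ * (4 * (1 + 3 / 2 * lam 0 ^ 2)) = 1 := by rw [hτ]; field_simp
  have hT1 : 32 * τ ≤ 1 := by nlinarith [sq_nonneg (lam 0)]
  -- the sum over the high-frequency modes of their bounds `3 κ / 4 ^ k` is half of `lam 0 ^ 2`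
  obtain ⟨κ, hκ⟩ : ∃ κ : ℝ, κ = lam 0 ^ 2 / 8 := ⟨_, rfl⟩
  have hκ0 : 0 < κ := by rw [hκ]; positivity
  obtain ⟨n, σ, δ, K, ρ, D⟩ := exists_isDesign hτ0 hκ0 hlam_pos hlam hω hφ1 hφ
  have hρ : ∀ k, 0 < ρ k := fun k => by rw [D.size]; positivity
  have hρK : ∀ k, ρ k * Real.exp (K k) = κ * (1 / 4) ^ k := fun k => by
    rw [D.size, mul_assoc, ← Real.exp_add]; simp
  have hρκ : ∀ k, ρ k ≤ κ * (1 / 4) ^ k := fun k => by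
    rw [← hρK]
    exact le_mul_of_one_le_right (hρ k).le (Real.one_le_exp (D.rate_nonneg k))
  have hS := D.staging
  set c := speed τ σ δ with hc
  choose U W hosc hU1 hU2 hU3 pk hpk1 hpk2 using fun k =>
    hS.exists_mode hT1 (hlam_pos (n k)) (hρ k) (D.resonance k) (D.rate_nonneg k) (D.rate k)
  have hcont : Continuous fun t => c t * lam 0 ^ 2 := hS.continuous_speed.mul continuous_const
  obtain ⟨u₀, v₀, hosc0, hu0, hv0, hcar⟩ := exists_carrier hcont (M := 3 / 2 * lam 0 ^ 2)
    (T := 32 * τ) (fun t => mul_nonneg (hS.speed_nonneg t) (sq_nonneg _))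
    (fun t => mul_le_mul_of_nonneg_right (hS.speed_le t) (sq_nonneg _)) hT.le
  -- the carrier has index `0`, the `k`-th resonant mode has index `k + 1`
  set ν := consSeq 0 n with hν
  set μ : ℕ → ℝ := fun j => lam (ν j) with hμ
  set V := consSeq u₀ U with hVdef
  set V' := consSeq v₀ W with hV'def
  have hνinj : Function.Injective ν := by
    have : StrictMono ν := strictMono_nat_of_lt_succ fun j => by
      rcases j with _ | j
      · exact D.index_pos 0
      · exact D.strictMono (Nat.lt_succ_self j)
    exact this.injective
  have hE : IsEigenSystem A (fun j => e (ν j)) μ :=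
    ⟨he.comp ν hνinj, fun j => hlam_pos _, fun j => hdom _, fun j => heig _⟩
  have hμ0 : ∀ j, lam 0 ≤ μ j := fun j => hlam_mono (Nat.zero_le _)
  have hgeo : Summable fun k : ℕ => √(3 * κ) * (1 / 2 : ℝ) ^ k :=
    (summable_geometric_of_lt_one (by norm_num) (by norm_num)).mul_left _
  have hgeosq : ∀ k : ℕ, (√(3 * κ) * (1 / 2 : ℝ) ^ k) ^ 2 = 3 * κ * (1 / 4) ^ k := fun k => by
    rw [mul_pow, Real.sq_sqrt (by positivity), ← pow_mul, mul_comm k 2, pow_mul]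
    norm_num
  have hV : IsModeFamily μ c (32 * τ) V V'
      (consSeq √(lam 0 * (lam 0 ^ 2 * 4 + 4)) fun k => √(3 * κ) * (1 / 2 : ℝ) ^ k) := by
    refine ⟨?_, ?_, summable_consSeq hgeo, ?_⟩
    · rintro (_ | k)
      · exact hosc0
      · exact hosc k
    · rintro (_ | k)
      · exact Real.sqrt_nonneg _
      · exact mul_nonneg (Real.sqrt_nonneg _) (by positivity)
    · rintro (_ | k) t ht
      · change lam 0 * (lam 0 ^ 2 * u₀ t ^ 2 + v₀ t ^ 2) ≤ √(lam 0 * (lam 0 ^ 2 * 4 + 4)) ^ 2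
        obtain ⟨h1, h2, -⟩ := hcar t ht
        have e1 : u₀ t ^ 2 ≤ 4 := by nlinarith [sq_abs (u₀ t), abs_nonneg (u₀ t)]
        have e2 : v₀ t ^ 2 ≤ 4 := by nlinarith [sq_abs (v₀ t), abs_nonneg (v₀ t)]
        rw [Real.sq_sqrt (by positivity)]
        gcongr
      · refine (hU1 k t ht).trans_eq ?_
        change _ = (√(3 * κ) * (1 / 2 : ℝ) ^ k) ^ 2
        rw [hgeosq, mul_assoc, hρK]
        ring
  -- `|A^{1/2} u|²` increases at a positive rate: it has a Lipschitz left inverse `Θ`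
  have hinc := hV.increase hl0 hμ0 (fun t ht => (hcar t ht).2.2) (q := lam 0 ^ 2 / 2) (by
    change lam 0 ^ 2 / 2 + ∑' k : ℕ, (√(3 * κ) * (1 / 2 : ℝ) ^ k) ^ 2 ≤ lam 0 ^ 2
    simp only [hgeosq]
    rw [tsum_mul_left, tsum_geometric_of_lt_one (by norm_num) (by norm_num), hκ]
    linarith)
  obtain ⟨Θ, hΘ1, hΘ2⟩ := exists_lipschitz_leftInverse (by positivity) hinc
  have h0mem : (0 : ℝ) ∈ Icc 0 (32 * τ) := ⟨le_rfl, by positivity⟩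
  have hsV : ∀ {t}, t ∈ Icc 0 (32 * τ) → Summable fun j => |V j t| :=
    fun ht => hV.summable_abs_pos hl0 hμ0 ht
  have hsV' : ∀ {t}, t ∈ Icc 0 (32 * τ) → Summable fun j => |V' j t| :=
    fun ht => hV.summable_abs_vel hl0 hμ0 ht
  have hnode : ∀ k, node τ k ≤ τ := fun k => by
    have := hS.node_anti (Nat.zero_le k)
    rwa [node_zero] at this
  have hst21 : ∀ k, stopTime (node τ k) (σ k) ≤ 21 * node τ k := fun k =>
    stopTime_le (hS.node_pos k) (hS.one_le k)
  have hnode21 : Tendsto (fun k => 21 * node τ k) atTop (𝓝 0) := by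
    simpa using (tendsto_node τ).const_mul 21
  have hpkmem : ∀ k, pk k ∈ Ioc 0 (32 * τ) := fun k =>
    ⟨(hS.node_pos k).trans (hpk1 k).1, by linarith [(hpk1 k).2, hst21 k, hnode k]⟩
  refine ⟨fun s => c (Θ s), 32 * τ, fun t => superpose (fun j => e (ν j)) fun j => V j t,
    fun t => superpose (fun j => e (ν j)) fun j => V' j t,
    fun s _ => ⟨hS.speed_nonneg _, hS.speed_le _⟩, by positivity, ?_, fun r _ => ?_,
    ⟨(hV.regularity hA hA0 hE hl0 hμ0).1, (hV.regularity hA hA0 hE hl0 hμ0).2, ?_⟩, ?_,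
    pk, hpkmem, ?_, ?_⟩
  · -- `m = c ∘ Θ` is `ω`-continuous since `Θ` is Lipschitz
    obtain ⟨N, hN⟩ := exists_nat_ge (lam 0 ^ 2 / 2)⁻¹
    refine ⟨10 * N, fun a _ b _ => ?_⟩
    have h1 := hS.abs_speed_sub_le hω D.modulus (Θ a) (Θ b)
    have h2 : |Θ a - Θ b| ≤ N * |a - b| :=
      (hΘ1 a b).trans (mul_le_mul_of_nonneg_right hN (abs_nonneg _))
    have h3 := hω.monotoneOn (mem_Ici.mpr (abs_nonneg _)) (mem_Ici.mpr (by positivity)) h2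
    have h4 := hω.mul_nat_le N (abs_nonneg (a - b))
    linarith
  · -- at time `0` the energy of the `k`-th mode is below `exp (-3 (k + 1) φ (λ k))`
    have hbound : ∀ᶠ k in atTop, ∀ x : ℝ, 0 ≤ x →
        x ≤ μ (k + 1) * (μ (k + 1) ^ 2 * V (k + 1) 0 ^ 2 + V' (k + 1) 0 ^ 2) →
        ‖x * Real.exp (r * φ (μ (k + 1)))‖ ≤ κ * (1 / 4) ^ k := by
      obtain ⟨k₀, hk₀⟩ := exists_nat_ge r
      filter_upwards [eventually_ge_atTop k₀] with k hk x hx0 hx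
      have h1 : x ≤ ρ k * Real.exp (-3 * (σ k * node τ k)) := hx.trans (hU2 k)
      have h2 := D.gevrey k
      have hφp := hφ1 (lam (n k)) (hlam_pos _).le
      have h3 : r ≤ 3 * (k + 1) := by
        have : (k₀ : ℝ) ≤ k := by exact_mod_cast hk
        linarith
      have h4 : Real.exp (-3 * (σ k * node τ k)) * Real.exp (r * φ (lam (n k))) ≤ 1 := by
        rw [← Real.exp_add, Real.exp_le_one_iff]
        have := mul_le_mul_of_nonneg_right h3 (by linarith : 0 ≤ φ (lam (n k)))
        linarith
      rw [Real.norm_eq_abs, abs_of_nonneg (by positivity)]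
      calc x * Real.exp (r * φ (lam (n k)))
          ≤ ρ k * Real.exp (-3 * (σ k * node τ k)) * Real.exp (r * φ (lam (n k))) :=
            mul_le_mul_of_nonneg_right h1 (Real.exp_pos _).le
        _ = ρ k * (Real.exp (-3 * (σ k * node τ k)) * Real.exp (r * φ (lam (n k)))) := by ring
        _ ≤ ρ k := mul_le_of_le_one_right (hρ k).le h4
        _ ≤ _ := hρκ k
    have hgeo4 : Summable fun k : ℕ => κ * (1 / 4 : ℝ) ^ k :=
      (summable_geometric_of_lt_one (by norm_num) (by norm_num)).mul_left _
    constructor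
    · refine superpose_mem_gevreySpace hA hA0 hE (hsV h0mem) ((summable_nat_add_iff 1).mp ?_)
      refine Summable.of_norm_bounded_eventually_nat hgeo4 ?_
      filter_upwards [hbound] with k hk
      have hpos : 0 < μ (k + 1) := hlam_pos _
      have h1 : (μ (k + 1) ^ 2) ^ (2 * (3 / 4) : ℝ) = μ (k + 1) ^ 3 := by
        rw [← Real.rpow_natCast_mul hpos.le, ← Real.rpow_natCast (μ (k + 1)) 3]
        norm_num
      refine hk _ (by positivity) ?_
      rw [h1]
      have : 0 ≤ μ (k + 1) * V' (k + 1) 0 ^ 2 := by positivity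
      linarith
    · refine superpose_mem_gevreySpace hA hA0 hE (hsV' h0mem) ((summable_nat_add_iff 1).mp ?_)
      refine Summable.of_norm_bounded_eventually_nat hgeo4 ?_
      filter_upwards [hbound] with k hk
      have hpos : 0 < μ (k + 1) := hlam_pos _
      have h1 : (μ (k + 1) ^ 2) ^ (2 * (1 / 4) : ℝ) = μ (k + 1) := by
        rw [← Real.rpow_natCast_mul hpos.le]
        norm_num
      refine hk _ (by positivity) ?_
      rw [h1]
      have : 0 ≤ μ (k + 1) * (μ (k + 1) ^ 2 * V (k + 1) 0 ^ 2) := by positivity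
      linarith
  · intro t ht w
    simp only
    rw [hV.sq_powNorm_half hA hA0 hE hl0 hμ0 ht, hΘ2 t ht]
    exact hasDerivWithinAt_inner_superpose hA hE (hV.summable_pos_bound hl0 hμ0)
      (hV.summable_vel_bound hl0 hμ0) (M := 3 / 2)
      (fun s _ => by rw [abs_of_nonneg (hS.speed_nonneg s)]; exact hS.speed_le s)
      (fun j s _ => ((hV.osc j).deriv_vel s).hasDerivWithinAt)
      (fun j _ hs => hV.abs_pos_le hl0 hμ0 j hs) (fun j _ hs => hV.abs_vel_le hl0 hμ0 j hs) ht w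
  · intro t ht β hβ
    have htI : t ∈ Icc 0 (32 * τ) := ⟨ht.1.le, ht.2⟩
    refine superpose_not_mem_phaseSpace hA hA0 hE (hsV htI) (hsV' htI) (ε := 2 / 3) (by norm_num)
      ?_ hβ
    rw [← Filter.map_add_atTop_eq_nat 1, eventually_map]
    filter_upwards [hnode21.eventually (gt_mem_nhds ht.1)] with k hk
    have hpos := hlam_pos (n k)
    have h1 := hU3 k t ⟨by linarith [hst21 k], ht.2⟩
    have h2 := D.derivative_loss k
    refine ⟨D.one_le k, ?_⟩
    change 2 / 3 ≤ lam (n k) ^ 2 * (lam (n k) ^ 2 * U k t ^ 2 + W k t ^ 2)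
    refine le_trans ?_ (mul_le_mul_of_nonneg_left h1 (sq_nonneg _))
    have h3 : lam (n k) ^ 2 * (2 / 3 * (δ k * ρ k / lam (n k) * Real.exp (-K k))) =
        2 / 3 * (lam (n k) * δ k * (ρ k * Real.exp (-K k))) := by field_simp
    linarith
  · exact tendsto_of_tendsto_of_tendsto_of_le_of_le tendsto_const_nhds hnode21
      (fun k => (hpkmem k).1.le) fun k => (hpk1 k).2.trans (hst21 k)
  · intro β hβ C
    refine Eventually.frequently ?_
    obtain ⟨k₁, hk₁⟩ := exists_nat_ge (2 * β - 1)⁻¹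
    obtain ⟨k₂, hk₂⟩ := exists_nat_ge (2 * (C : ℝ) ^ 2)
    filter_upwards [eventually_ge_atTop k₁, eventually_ge_atTop k₂] with k hk1 hk2
    have hpos := hlam_pos (n k)
    have hγ : 0 < 2 * β - 1 := by linarith
    have h1 : 1 ≤ (2 * β - 1) * ((k : ℝ) + 1) := by
      have : (k₁ : ℝ) ≤ k := by exact_mod_cast hk1
      have h2 : (2 * β - 1)⁻¹ ≤ (k : ℝ) + 1 := by linarith
      rwa [inv_le_iff_one_le_mul₀' hγ] at h2
    have h2 := D.le_rpow hρ h1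
    have h3 : U k (pk k) ^ 2 * (lam (n k) ^ 2) ^ (2 * ((β + 1) / 2)) =
        lam (n k) * (lam (n k) ^ 2 * U k (pk k) ^ 2) * lam (n k) ^ (2 * β - 1) := by
      have e1 : (lam (n k) ^ 2) ^ (2 * ((β + 1) / 2)) =
          lam (n k) ^ (3 : ℕ) * lam (n k) ^ (2 * β - 1) := by
        rw [← Real.rpow_natCast_mul hpos.le, ← Real.rpow_natCast, ← Real.rpow_add hpos]
        congr 1
        push_cast
        ring
      rw [e1]
      ring
    have h4 : (C : ℝ) ^ 2 < U k (pk k) ^ 2 * (lam (n k) ^ 2) ^ (2 * ((β + 1) / 2)) := by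
      have e1 := mul_le_mul_of_nonneg_right (hpk2 k) (Real.rpow_nonneg hpos.le (2 * β - 1))
      have e2 : (k₂ : ℝ) ≤ k := by exact_mod_cast hk2
      rw [h3]
      linarith
    refine lt_of_lt_of_le ?_ (le_powNorm_superpose hA hA0 hE
      (hsV ⟨(hpkmem k).1.le, (hpkmem k).2⟩) ((β + 1) / 2) (k + 1))
    change (C : ℝ≥0∞) < ENNReal.ofReal
      (U k (pk k) ^ 2 * (lam (n k) ^ 2) ^ (2 * ((β + 1) / 2))) ^ (1 / 2 : ℝ)
    rw [ENNReal.ofReal_rpow_of_nonneg (by positivity) (by norm_num), ← Real.sqrt_eq_rpow,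
      ← ENNReal.ofReal_coe_nnreal, ENNReal.ofReal_lt_ofReal_iff_of_nonneg C.coe_nonneg]
    exact Real.lt_sqrt_of_sq_lt h4
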